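/- Let $n\ge 1$ and let $X_1,\dots,X_n$ be independent real random variables on a common probability space, each having a density (with respect to Lebesgue measure) and finite variance. Let $\mathcal{C}$ be an arbitrary collection of subsets of $[n]=\{1,\dots,n\}$, and let $r$ be the maximum, over $i\in[n]$, of the number of sets in $\mathcal{C}$ that contain $i$. Put $T_n=\sum_{i\in[n]}X_i$ and $T^{(s)}=\sum_{i\in s}X_i$ for $s\in\mathcal{C}$, and let $w=(w_s)_{s\in\mathcal{C}}$ be any probability distribution on $\mathcal{C}$. For a random variable $Y$ with a (locally) absolutely continuous density $f$, let $\rho=f'/f$ be its score function and $I(Y)=E[\rho(Y)^2]\in[0,\infty]$ its Fisher information; put $I(Y)=\infty$ if $Y$ has no absolutely continuous density. Use the convention $0\cdot\infty=0$. If $T^{(s)}$ has an absolutely continuous density for each $s\in\mathcal{C}$, then $$I(T_n)\le r\sum_{s\in\mathcal{C}}w_s^2\,I(T^{(s)}).$$ Moreover, if $n\ge 2$ and $\mathcal{C}$ is discriminating (that is, for any distinct $i,j\in[n]$ there is a set in $\mathcal{C}$ that contains $i$ but not $j$), then both sides can be finite and equal only if each $X_i$ is normally distributed. -/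

import Mathlib

open MeasureTheory ProbabilityTheory
open scoped ENNReal NNReal

/-- `f` is an absolutely continuous probability density function of the law `μ` on `ℝ`: it is
nonnegative, absolutely continuous on every compact interval, and the density of `μ` with respect
to Lebesgue measure. -/
structure IsACDensity (f : ℝ → ℝ) (μ : Measure ℝ) : Prop where
  nonneg : ∀ x, 0 ≤ f x
  absCont : ∀ a b : ℝ, AbsolutelyContinuousOnInterval f a b
  eq_withDensity : μ = volume.withDensity fun x => ENNReal.ofReal (f x)

/-- The law `μ` has an absolutely continuous density. -/
def HasACDensity (μ : Measure ℝ) : Prop := ∃ f : ℝ → ℝ, IsACDensity f μ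

/-- The score function `f' / f`, defined almost everywhere for the law with density `f`. -/
noncomputable def score (f : ℝ → ℝ) (x : ℝ) : ℝ := deriv f x / f x

/-- The Fisher information `E[ρ(X)²] ∈ [0, ∞]` of a random variable `X` with law `μ`, where `ρ` is
the score function of the absolutely continuous density of `μ`. That density is unique (see
`fisherInfo_eq`), so the infimum is over at most one `f`; it is `∞` if there is no such density. -/
noncomputable def fisherInfo (μ : Measure ℝ) : ℝ≥0∞ :=
  ⨅ (f : ℝ → ℝ) (_ : IsACDensity f μ), ∫⁻ x, ENNReal.ofReal (score f x ^ 2) ∂μ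

theorem IsACDensity.continuous {f : ℝ → ℝ} {μ : Measure ℝ} (h : IsACDensity f μ) :
    Continuous f := by
  rw [continuous_iff_continuousAt]
  intro x
  have hc := (h.absCont (x - 1) (x + 1)).continuousOn
  rw [Set.uIcc_of_le (by linarith)] at hc
  exact hc.continuousAt (Icc_mem_nhds (by linarith) (by linarith))

theorem IsACDensity.unique {f g : ℝ → ℝ} {μ : Measure ℝ} [IsFiniteMeasure μ]
    (hf : IsACDensity f μ) (hg : IsACDensity g μ) : f = g := by
  have hfm := hf.continuous.measurable.ennreal_ofReal
  have hgm := hg.continuous.measurable.ennreal_ofReal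
  have hfin : ∫⁻ x, ENNReal.ofReal (f x) ≠ ∞ := by
    have : μ Set.univ = ∫⁻ x, ENNReal.ofReal (f x) := by
      rw [hf.eq_withDensity, withDensity_apply _ MeasurableSet.univ, setLIntegral_univ]
    rw [← this]
    exact measure_ne_top _ _
  have hae := (withDensity_eq_iff hfm.aemeasurable hgm.aemeasurable hfin).1
    (hf.eq_withDensity.symm.trans hg.eq_withDensity)
  refine (hf.continuous.ae_eq_iff_eq volume hg.continuous).1 ?_
  filter_upwards [hae] with x hx
  exact (ENNReal.ofReal_eq_ofReal_iff (hf.nonneg x) (hg.nonneg x)).1 hx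

theorem fisherInfo_eq {f : ℝ → ℝ} {μ : Measure ℝ} [IsFiniteMeasure μ] (hf : IsACDensity f μ) :
    fisherInfo μ = ∫⁻ x, ENNReal.ofReal (score f x ^ 2) ∂μ := by
  refine le_antisymm (iInf₂_le f hf) (le_iInf₂ fun g hg => ?_)
  rw [hf.unique hg]

/-- `r`: the maximum number of sets of the collection `C` in which any one index appears. -/
def maxDegree {n : ℕ} (C : Finset (Finset (Fin n))) : ℕ :=
  Finset.univ.sup fun i : Fin n => (C.filter fun s => i ∈ s).card

/-- For any distinct indices `i`, `j` there is a set in `C` that contains `i` but not `j`. -/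
def Discriminating {n : ℕ} (C : Finset (Finset (Fin n))) : Prop :=
  ∀ i j : Fin n, i ≠ j → ∃ s ∈ C, i ∈ s ∧ j ∉ s

/-- The law of the subset sum `∑ i ∈ s, X i`. -/
noncomputable def sumLaw {Ω : Type*} [MeasurableSpace Ω] (P : Measure Ω) {n : ℕ}
    (X : Fin n → Ω → ℝ) (s : Finset (Fin n)) : Measure ℝ :=
  P.map fun ω => ∑ i ∈ s, X i ω

/-!
Write `T` for the total sum, `Tₛ` for the subset sums, `ρ` and `ρₛ` for their scores.

**The inequality.** The score of a sum is the conditional expectation of the score of a summand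
(`IsACDensity.integral_score_mul_comp_add`). Hence `ρ(T)` is, in `L²`, a projection of
`V = ∑ wₛ ρₛ(Tₛ)`, and `I(T) = ‖ρ(T)‖² ≤ ‖V‖²`. It remains to prove the *variance drop inequality*
`‖∑ Uₛ‖² ≤ r ∑ ‖Uₛ‖²` for centred `Uₛ` depending on the coordinates in `s` only
(`IsCoordProj.norm_sum_sq_le`). Revealing the coordinates one at a time splits each `Uₛ` into
orthogonal martingale increments. The increment at coordinate `k` vanishes unless `k ∈ s`, so at
most `r` of the vectors `Uₛ` contribute to each coordinate, and Cauchy-Schwarz gives the factor `r`.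

**Equality.** Then `ρ(T) = V`, and for each `k` the increments at `k` of all `Uₛ` with `k ∈ s`
coincide, whatever the order in which the coordinates are revealed. If `k ∉ s₀` and `j ∈ s₀`, the
collection contains a set with `k` but without `j`, so the increment at `k` does not depend on the
coordinate `j`. Therefore `V` is a function of the coordinates in `s₀` plus a function of the others
(`IsCoordProj.sum_eq_add_compl`). For `s₀ ≠ univ` of positive weight, this says that
`ρ(X + Y) = g(X) + k(Y)` for the independent variables `X = T_{s₀}` and `Y = T - X`.

Integrating in `x`, all translates of `log f`, with `f` the density of `T`, by points `y` of a set of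
full measure differ by affine functions on the intervals where the density of `X` is positive. As the
differences of such `y` fill a neighbourhood of `0` (Steinhaus), the increments of `log f` over small
distances are locally affine, so `log f` is locally a quadratic polynomial where `f` is positive.
A clopen argument makes this global, and `T` is normal
(`IsACDensity.exists_eq_gaussianReal_of_score_eq_add`). Finally each `Xᵢ` is normal by Cramér's
decomposition theorem (`exists_eq_gaussianReal_of_conv_eq`): the moment generating function of `Xᵢ`
is entire, has no zeros and is of order at most two, so it is the exponential of a quadratic
polynomial by the Borel-Carathéodory theorem.
-/

/-! ### Variance drop in a Hilbert space with commuting projections -/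

section Hilbert

variable {H : Type*} [NormedAddCommGroup H] [InnerProductSpace ℝ H]
variable {ι : Type*} [Fintype ι] [DecidableEq ι]

/-- A family of commuting orthogonal projections indexed by finite sets of coordinates, modelled on
the conditional expectations given the coordinates in `t`. -/
structure IsCoordProj (Q : Finset ι → H →ₗ[ℝ] H) : Prop where
  inner_left : ∀ t u v, inner ℝ (Q t u) v = inner ℝ u (Q t v)
  comp : ∀ s t v, Q s (Q t v) = Q (s ∩ t) v
  univ : ∀ v, Q Finset.univ v = v

/-- The defect in the Cauchy-Schwarz inequality for a sum of vectors. -/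
theorem card_mul_sum_norm_sq_sub {α : Type*} (A : Finset α) (v : α → H) :
    (A.card : ℝ) * ∑ s ∈ A, ‖v s‖ ^ 2 - ‖∑ s ∈ A, v s‖ ^ 2 =
      (1 / 2) * ∑ s ∈ A, ∑ t ∈ A, ‖v s - v t‖ ^ 2 := by
  have h : ‖∑ s ∈ A, v s‖ ^ 2 = ∑ s ∈ A, ∑ t ∈ A, inner ℝ (v s) (v t) := by
    rw [← real_inner_self_eq_norm_sq, sum_inner]
    simp_rw [inner_sum]
  simp_rw [h, norm_sub_sq_real, Finset.sum_add_distrib, Finset.sum_sub_distrib, Finset.sum_const,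
    ← Finset.mul_sum, nsmul_eq_mul, ← Finset.mul_sum]
  ring

namespace IsCoordProj

variable {Q : Finset ι → H →ₗ[ℝ] H} {C : Finset (Finset ι)} {U : Finset ι → H} {r : ℕ}

theorem inner_self_left (hQ : IsCoordProj Q) (t : Finset ι) (u v : H) :
    inner ℝ (Q t u) (Q t v) = inner ℝ (Q t u) v := by
  rw [hQ.inner_left, hQ.comp, Finset.inter_self, hQ.inner_left]

/-- Pythagoras for the increment obtained by revealing the coordinate `k`. -/
theorem norm_insert_sq (hQ : IsCoordProj Q) (t : Finset ι) (k : ι) (v : H) :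
    ‖Q (insert k t) v‖ ^ 2 = ‖Q t v‖ ^ 2 + ‖Q (insert k t) v - Q t v‖ ^ 2 := by
  have h : inner ℝ (Q (insert k t) v) (Q t v) = ‖Q t v‖ ^ 2 := by
    rw [← real_inner_self_eq_norm_sq, hQ.inner_left, hQ.comp,
      Finset.inter_eq_right.2 (Finset.subset_insert k t), hQ.inner_self_left,
      real_inner_comm]
  rw [norm_sub_sq_real, h]
  ring

/-- The increment in direction `k` kills every vector that does not depend on the coordinate
`k`. -/
theorem insert_sub_eq_zero (hQ : IsCoordProj Q) {s : Finset ι} {u : H} (hu : Q s u = u)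
    (t : Finset ι) {k : ι} (hk : k ∉ s) : Q (insert k t) u - Q t u = 0 := by
  rw [← hu, hQ.comp, hQ.comp, Finset.insert_inter_of_notMem hk, sub_self]

/-- The slack of the variance drop inequality after projecting on the coordinates in `t` grows by
at least the mutual distances of the increments when a coordinate `k` is added. -/
theorem slack_insert (hQ : IsCoordProj Q) (hU : ∀ s ∈ C, Q s (U s) = U s)
    (hr : ∀ i, (C.filter fun s => i ∈ s).card ≤ r) (t : Finset ι) (k : ι) :
    r * ∑ s ∈ C, ‖Q t (U s)‖ ^ 2 - ‖Q t (∑ s ∈ C, U s)‖ ^ 2 +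
        (1 / 2) * ∑ s ∈ C with k ∈ s, ∑ s' ∈ C with k ∈ s',
          ‖(Q (insert k t) (U s) - Q t (U s)) - (Q (insert k t) (U s') - Q t (U s'))‖ ^ 2 ≤
      r * ∑ s ∈ C, ‖Q (insert k t) (U s)‖ ^ 2 - ‖Q (insert k t) (∑ s ∈ C, U s)‖ ^ 2 := by
  have h0 : ∀ s ∈ C, ¬ k ∈ s → Q (insert k t) (U s) - Q t (U s) = 0 := fun s hs hk =>
    hQ.insert_sub_eq_zero (hU s hs) t hk
  have h1 : ∑ s ∈ C, ‖Q (insert k t) (U s) - Q t (U s)‖ ^ 2 =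
      ∑ s ∈ C with k ∈ s, ‖Q (insert k t) (U s) - Q t (U s)‖ ^ 2 := by
    rw [Finset.sum_filter]
    refine Finset.sum_congr rfl fun s hs => ?_
    split_ifs with hk
    · rfl
    · simp [h0 s hs hk]
  have h2 : Q (insert k t) (∑ s ∈ C, U s) - Q t (∑ s ∈ C, U s) =
      ∑ s ∈ C with k ∈ s, (Q (insert k t) (U s) - Q t (U s)) := by
    rw [map_sum, map_sum, ← Finset.sum_sub_distrib, Finset.sum_filter]
    refine Finset.sum_congr rfl fun s hs => ?_
    split_ifs with hk
    · rfl
    · exact h0 s hs hk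
  have h3 := card_mul_sum_norm_sq_sub (C.filter fun s => k ∈ s)
    fun s => Q (insert k t) (U s) - Q t (U s)
  have h4 : ((C.filter fun s => k ∈ s).card : ℝ) ≤ r := by exact_mod_cast hr k
  have h5 : 0 ≤ ∑ s ∈ C with k ∈ s, ‖Q (insert k t) (U s) - Q t (U s)‖ ^ 2 := by positivity
  simp_rw [hQ.norm_insert_sq t k, h2, Finset.sum_add_distrib, h1]
  nlinarith [mul_le_mul_of_nonneg_right h4 h5]

theorem slack_mono (hQ : IsCoordProj Q) (hU : ∀ s ∈ C, Q s (U s) = U s)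
    (hr : ∀ i, (C.filter fun s => i ∈ s).card ≤ r) {t t' : Finset ι} (h : t ⊆ t') :
    r * ∑ s ∈ C, ‖Q t (U s)‖ ^ 2 - ‖Q t (∑ s ∈ C, U s)‖ ^ 2 ≤
      r * ∑ s ∈ C, ‖Q t' (U s)‖ ^ 2 - ‖Q t' (∑ s ∈ C, U s)‖ ^ 2 := by
  suffices H : ∀ a : Finset ι, r * ∑ s ∈ C, ‖Q t (U s)‖ ^ 2 - ‖Q t (∑ s ∈ C, U s)‖ ^ 2 ≤
      r * ∑ s ∈ C, ‖Q (t ∪ a) (U s)‖ ^ 2 - ‖Q (t ∪ a) (∑ s ∈ C, U s)‖ ^ 2 by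
    simpa [Finset.union_eq_right.2 h] using H t'
  intro a
  induction a using Finset.induction_on with
  | empty => simp
  | insert k a _ ih =>
    rw [Finset.union_insert]
    refine ih.trans (le_trans ?_ (hQ.slack_insert hU hr (t ∪ a) k))
    exact le_add_of_nonneg_right (by positivity)

/-- The **variance drop inequality**. -/
theorem norm_sum_sq_le (hQ : IsCoordProj Q) (hU : ∀ s ∈ C, Q s (U s) = U s)
    (h0 : ∀ s ∈ C, Q ∅ (U s) = 0) (hr : ∀ i, (C.filter fun s => i ∈ s).card ≤ r) :
    ‖∑ s ∈ C, U s‖ ^ 2 ≤ r * ∑ s ∈ C, ‖U s‖ ^ 2 := by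
  have h := hQ.slack_mono hU hr (Finset.empty_subset Finset.univ)
  have h1 : Q ∅ (∑ s ∈ C, U s) = 0 := by rw [map_sum]; exact Finset.sum_eq_zero h0
  have h2 : ∑ s ∈ C, ‖Q ∅ (U s)‖ ^ 2 = 0 := Finset.sum_eq_zero fun s hs => by simp [h0 s hs]
  simp only [hQ.univ, h1, h2] at h
  simp only [mul_zero, norm_zero] at h
  linarith

/-- In the equality case of the variance drop inequality, all summands depending on the coordinate
`k` have the same increments in direction `k`. -/
theorem insert_sub_congr (hQ : IsCoordProj Q) (hU : ∀ s ∈ C, Q s (U s) = U s)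
    (h0 : ∀ s ∈ C, Q ∅ (U s) = 0) (hr : ∀ i, (C.filter fun s => i ∈ s).card ≤ r)
    (heq : ‖∑ s ∈ C, U s‖ ^ 2 = r * ∑ s ∈ C, ‖U s‖ ^ 2) (t : Finset ι) {k : ι}
    {s s' : Finset ι} (hs : s ∈ C) (hs' : s' ∈ C) (hk : k ∈ s) (hk' : k ∈ s') :
    Q (insert k t) (U s) - Q t (U s) = Q (insert k t) (U s') - Q t (U s') := by
  have h := hQ.slack_insert hU hr t k
  have h3 := hQ.slack_mono hU hr (Finset.empty_subset t)
  have h4 := hQ.slack_mono hU hr (Finset.subset_univ (insert k t))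
  have h1 : Q ∅ (∑ s ∈ C, U s) = 0 := by rw [map_sum]; exact Finset.sum_eq_zero h0
  have h2 : ∑ s ∈ C, ‖Q ∅ (U s)‖ ^ 2 = 0 := Finset.sum_eq_zero fun s hs => by simp [h0 s hs]
  simp only [hQ.univ] at h4
  rw [h1, h2, mul_zero, norm_zero] at h3
  have h5 : ‖(Q (insert k t) (U s) - Q t (U s)) - (Q (insert k t) (U s') - Q t (U s'))‖ ^ 2 ≤
      ∑ s ∈ C with k ∈ s, ∑ s' ∈ C with k ∈ s',
        ‖(Q (insert k t) (U s) - Q t (U s)) - (Q (insert k t) (U s') - Q t (U s'))‖ ^ 2 := by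
    refine le_trans ?_ (Finset.single_le_sum (f := fun s => ∑ s' ∈ C with k ∈ s',
        ‖(Q (insert k t) (U s) - Q t (U s)) - (Q (insert k t) (U s') - Q t (U s'))‖ ^ 2)
      (fun _ _ => by positivity) (Finset.mem_filter.2 ⟨hs, hk⟩))
    exact Finset.single_le_sum (f := fun s' =>
        ‖(Q (insert k t) (U s) - Q t (U s)) - (Q (insert k t) (U s') - Q t (U s'))‖ ^ 2)
      (fun _ _ => by positivity) (Finset.mem_filter.2 ⟨hs', hk'⟩)
  have h6 : ‖(Q (insert k t) (U s) - Q t (U s)) - (Q (insert k t) (U s') - Q t (U s'))‖ ^ 2 ≤ 0 := by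
    linarith
  have h7 := pow_eq_zero_iff (two_ne_zero) |>.1 (le_antisymm h6 (by positivity))
  exact sub_eq_zero.1 (norm_eq_zero.1 h7)

theorem eq_of_forall_compl_singleton (hQ : IsCoordProj Q) {v : H} (s : Finset ι)
    (h : ∀ j ∈ s, Q {j}ᶜ v = v) : Q sᶜ v = v := by
  induction s using Finset.induction_on with
  | empty => simp [hQ.univ]
  | insert j s _ ih =>
    rw [Finset.insert_eq, Finset.compl_union, ← hQ.comp,
      ih fun i hi => h i (Finset.mem_insert_of_mem hi), h j (Finset.mem_insert_self j s)]

/-- In the equality case of the variance drop inequality for a discriminating collection, the sum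
splits as a function of the coordinates in `s₀` plus a function of the other coordinates, for each
`s₀` in the collection. -/
theorem sum_eq_add_compl (hQ : IsCoordProj Q) (hU : ∀ s ∈ C, Q s (U s) = U s)
    (h0 : ∀ s ∈ C, Q ∅ (U s) = 0) (hr : ∀ i, (C.filter fun s => i ∈ s).card ≤ r)
    (heq : ‖∑ s ∈ C, U s‖ ^ 2 = r * ∑ s ∈ C, ‖U s‖ ^ 2)
    (hC : ∀ i j : ι, i ≠ j → ∃ s ∈ C, i ∈ s ∧ j ∉ s) (s₀ : Finset ι) :
    ∑ s ∈ C, U s = Q s₀ (∑ s ∈ C, U s) + Q s₀ᶜ (∑ s ∈ C, U s) := by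
  set S := ∑ s ∈ C, U s with hS
  have h1 : Q ∅ S = 0 := by rw [hS, map_sum]; exact Finset.sum_eq_zero h0
  -- An increment in a direction `k ∉ s₀` equals that of a summand which is independent of any
  -- given `j ∈ s₀`.
  have hinc : ∀ (t : Finset ι) (k : ι), k ∉ s₀ →
      Q s₀ᶜ (Q (insert k t) S - Q t S) = Q (insert k t) S - Q t S := by
    intro t k hk
    rw [hS, map_sum, map_sum, ← Finset.sum_sub_distrib, map_sum]
    refine Finset.sum_congr rfl fun s hs => ?_
    by_cases hks : k ∈ s
    · refine hQ.eq_of_forall_compl_singleton s₀ fun j hj => ?_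
      obtain ⟨s', hs', hks', hjs'⟩ := hC k j (fun h => hk (h ▸ hj))
      rw [hQ.insert_sub_congr hU h0 hr heq t hs hs' hks hks', map_sub, hQ.comp, hQ.comp]
      have hsub : ∀ a, Q ({j}ᶜ ∩ a) (U s') = Q a (U s') := fun a => by
        have hsub : s' ⊆ {j}ᶜ := by
          intro i hi
          simp only [Finset.mem_compl, Finset.mem_singleton]
          exact fun h => hjs' (h ▸ hi)
        rw [← hU s' hs', hQ.comp, hQ.comp, Finset.inter_right_comm,
          Finset.inter_eq_right.2 hsub, Finset.inter_comm]
      rw [hsub, hsub]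
    · rw [hQ.insert_sub_eq_zero (hU s hs) t hks, map_zero]
  have key : ∀ t : Finset ι, Q s₀ᶜ (Q (s₀ ∪ t) S - Q s₀ S) = Q (s₀ ∪ t) S - Q s₀ S := by
    intro t
    induction t using Finset.induction_on with
    | empty => simp
    | insert k t _ ih =>
      rw [Finset.union_insert]
      by_cases hk : k ∈ s₀
      · rwa [Finset.insert_eq_of_mem (Finset.mem_union_left _ hk)]
      · rw [← sub_add_sub_cancel _ (Q (s₀ ∪ t) S), map_add, ih, hinc _ _ hk]
  have h2 := key Finset.univ
  rw [Finset.union_eq_right.2 (Finset.subset_univ s₀), hQ.univ, map_sub, hQ.comp, Finset.inter_comm, Finset.inter_compl, h1,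
    sub_zero] at h2
  rw [h2]
  abel

end IsCoordProj
end Hilbert

/-! ### Conditional expectations on a product space -/

section ProductSpace

variable {ι : Type*} [DecidableEq ι]

theorem piecewise_piecewise_zero (t : Finset ι) (x y : ι → ℝ) :
    t.piecewise (t.piecewise x 0) y = t.piecewise x y := by
  ext i
  by_cases hi : i ∈ t <;> simp [hi]

theorem measurable_piecewise (t : Finset ι) :
    Measurable fun z : (ι → ℝ) × (ι → ℝ) => t.piecewise z.1 z.2 := by
  refine measurable_pi_lambda _ fun i => ?_
  by_cases hi : i ∈ t
  · simp only [Finset.piecewise_eq_of_mem _ _ _ hi]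
    fun_prop
  · simp only [Finset.piecewise_eq_of_notMem _ _ _ hi]
    fun_prop

theorem sum_piecewise_left (s : Finset ι) (x y : ι → ℝ) :
    ∑ i ∈ s, s.piecewise x y i = ∑ i ∈ s, x i :=
  Finset.sum_congr rfl fun i hi => by simp [hi]

theorem sum_piecewise_right {s t : Finset ι} (h : Disjoint s t) (x y : ι → ℝ) :
    ∑ i ∈ t, s.piecewise x y i = ∑ i ∈ t, y i :=
  Finset.sum_congr rfl fun i hi => by simp [Finset.disjoint_right.1 h hi]

/-- The σ-algebra generated by the coordinates in `t`. The other coordinates are replaced by `0`,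
which keeps all these σ-algebras on the same space. -/
abbrev coordSigma (t : Finset ι) : MeasurableSpace (ι → ℝ) :=
  MeasurableSpace.comap (fun x => t.piecewise x 0) inferInstance

theorem coordSigma_le (t : Finset ι) : coordSigma t ≤ MeasurableSpace.pi :=
  Measurable.comap_le ((measurable_piecewise t).comp (measurable_id.prodMk measurable_const))

variable [Fintype ι]

/-- Resampling the coordinates outside `t` independently preserves a product law. -/
theorem measurePreserving_piecewise (μ : ι → Measure ℝ) [∀ i, IsProbabilityMeasure (μ i)]
    (t : Finset ι) :
    MeasurePreserving (fun z : (ι → ℝ) × (ι → ℝ) => t.piecewise z.1 z.2)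
      ((Measure.pi μ).prod (Measure.pi μ)) (Measure.pi μ) := by
  refine ⟨measurable_piecewise t, (Measure.pi_eq fun s hs => ?_).symm⟩
  rw [Measure.map_apply (measurable_piecewise t) (MeasurableSet.univ_pi hs)]
  have hset : (fun z : (ι → ℝ) × (ι → ℝ) => t.piecewise z.1 z.2) ⁻¹' Set.univ.pi s =
      (Set.univ.pi (t.piecewise s fun _ => Set.univ)) ×ˢ
        (Set.univ.pi (t.piecewise (fun _ => Set.univ) s)) := by
    ext z
    simp only [Set.mem_preimage, Set.mem_pi, Set.mem_univ, true_imp_iff, Set.mem_prod,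
      ← forall_and]
    refine forall_congr' fun i => ?_
    by_cases hi : i ∈ t <;> simp [hi]
  rw [hset, Measure.prod_prod, Measure.pi_pi, Measure.pi_pi, ← Finset.prod_mul_distrib]
  refine Finset.prod_congr rfl fun i _ => ?_
  by_cases hi : i ∈ t <;> simp [hi]

/-- The conditional expectation given the coordinates in `t`, as an operator on `L²`. -/
noncomputable def coordProj (μ : ι → Measure ℝ) [∀ i, IsProbabilityMeasure (μ i)] (t : Finset ι) :
    Lp ℝ 2 (Measure.pi μ) →ₗ[ℝ] Lp ℝ 2 (Measure.pi μ) :=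
  (lpMeas ℝ ℝ (coordSigma t) 2 (Measure.pi μ)).subtype ∘ₗ
    (condExpL2 ℝ ℝ (coordSigma_le t)).toLinearMap

variable (μ : ι → Measure ℝ) [∀ i, IsProbabilityMeasure (μ i)]

/-- Conditioning a product law on the coordinates in `t` integrates out the other coordinates. -/
theorem coordProj_toLp (t : Finset ι) {F : (ι → ℝ) → ℝ} (hF : Measurable F)
    (hF2 : MemLp F 2 (Measure.pi μ)) :
    coordProj μ t (hF2.toLp F) =ᵐ[Measure.pi μ]
      fun x => ∫ y, F (t.piecewise x y) ∂Measure.pi μ := by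
  have hmp := measurePreserving_piecewise μ t
  have h1 : coordProj μ t (hF2.toLp F) =ᵐ[Measure.pi μ] (Measure.pi μ)[F | coordSigma t] :=
    hF2.condExpL2_ae_eq_condExp (coordSigma_le t)
  refine h1.trans (Filter.EventuallyEq.symm ?_)
  have hint : Integrable (fun z : (ι → ℝ) × (ι → ℝ) => F (t.piecewise z.1 z.2))
      ((Measure.pi μ).prod (Measure.pi μ)) :=
    hmp.integrable_comp_of_integrable (hF2.integrable one_le_two)
  refine ae_eq_condExp_of_forall_setIntegral_eq (coordSigma_le t) (hF2.integrable one_le_two)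
    (fun s _ _ => hint.integral_prod_left.integrableOn) ?_ ?_
  · intro s hs _
    have hs' := coordSigma_le t s hs
    obtain ⟨s₀, -, rfl⟩ := hs
    set s := (fun x : ι → ℝ => t.piecewise x 0) ⁻¹' s₀
    have hmem : ∀ x y, t.piecewise x y ∈ s ↔ x ∈ s := fun x y => by
      have : t.piecewise (t.piecewise x y) 0 = t.piecewise x (0 : ι → ℝ) := by
        ext i
        by_cases hi : i ∈ t <;> simp [hi]
      simp [s, this]
    have h2 : ∫ x, s.indicator F x ∂Measure.pi μ = ∫ x, (∫ y, s.indicator F (t.piecewise x y)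
        ∂Measure.pi μ) ∂Measure.pi μ := by
      have h3 := hmp.integrable_comp_of_integrable ((hF2.integrable one_le_two).indicator hs')
      rw [← integral_prod (fun z : (ι → ℝ) × (ι → ℝ) => s.indicator F (t.piecewise z.1 z.2)) h3,
        ← integral_map (f := s.indicator F) hmp.aemeasurable (by
          rw [hmp.map_eq]; exact (hF.indicator hs').aestronglyMeasurable), hmp.map_eq]
    rw [← integral_indicator hs', ← integral_indicator hs', h2]
    refine integral_congr_ae (Filter.Eventually.of_forall fun x => ?_)
    by_cases hx : x ∈ s <;> simp [Set.indicator, hmem, hx]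
  · have hG : StronglyMeasurable fun x => ∫ y, F (t.piecewise x y) ∂Measure.pi μ :=
      (hF.comp (measurable_piecewise t)).stronglyMeasurable.integral_prod_right'
    have h2 : (fun x => ∫ y, F (t.piecewise x y) ∂Measure.pi μ) =
        (fun x => ∫ y, F (t.piecewise x y) ∂Measure.pi μ) ∘ fun x => t.piecewise x 0 := by
      ext x
      simp only [Function.comp, piecewise_piecewise_zero]
    rw [h2]
    have h3 : Measurable[coordSigma t] fun x : ι → ℝ => t.piecewise x (0 : ι → ℝ) :=
      comap_measurable _
    exact (hG.comp_measurable h3).aestronglyMeasurable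

theorem coordProj_toLp_eq (t : Finset ι) {F G : (ι → ℝ) → ℝ} (hF : Measurable F)
    (hF2 : MemLp F 2 (Measure.pi μ)) (hG2 : MemLp G 2 (Measure.pi μ))
    (h : ∀ x, ∫ y, F (t.piecewise x y) ∂Measure.pi μ = G x) :
    coordProj μ t (hF2.toLp F) = hG2.toLp G := by
  refine Lp.ext ((coordProj_toLp μ t hF hF2).trans ?_)
  filter_upwards [hG2.coeFn_toLp] with x hx
  rw [hx, h]

/-- By independence, conditioning first on `t` and then on `s` is conditioning on `s ∩ t`. -/
theorem isCoordProj_coordProj : IsCoordProj (coordProj μ) where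
  inner_left t u v := inner_condExpL2_left_eq_right (coordSigma_le t)
  comp s t v := by
    obtain ⟨F, hF, hFv⟩ : ∃ F : (ι → ℝ) → ℝ, Measurable F ∧ v =ᵐ[Measure.pi μ] F :=
      ⟨_, (Lp.stronglyMeasurable v).measurable, Filter.EventuallyEq.rfl⟩
    have hF2 : MemLp F 2 (Measure.pi μ) := (memLp_congr_ae hFv).1 (Lp.memLp v)
    obtain rfl : v = hF2.toLp F := Lp.ext (hFv.trans hF2.coeFn_toLp.symm)
    have h1 := coordProj_toLp μ t hF hF2
    set G : (ι → ℝ) → ℝ := fun x => ∫ y, F (t.piecewise x y) ∂Measure.pi μ with hG_def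
    have hG : Measurable G :=
      (hF.comp (measurable_piecewise t)).stronglyMeasurable.integral_prod_right'.measurable
    have hG2 : MemLp G 2 (Measure.pi μ) := (memLp_congr_ae h1).1 (Lp.memLp _)
    have h2 : coordProj μ t (hF2.toLp F) = hG2.toLp G := Lp.ext (h1.trans hG2.coeFn_toLp.symm)
    rw [h2]
    refine Lp.ext ((coordProj_toLp μ s hG hG2).trans
      (Filter.EventuallyEq.trans ?_ (coordProj_toLp μ (s ∩ t) hF hF2).symm))
    have hmp := measurePreserving_piecewise μ t
    have hint : ∀ᵐ x ∂Measure.pi μ,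
        Integrable (fun y => F ((s ∩ t).piecewise x y)) (Measure.pi μ) :=
      ((measurePreserving_piecewise μ (s ∩ t)).integrable_comp_of_integrable
        (hF2.integrable one_le_two)).prod_right_ae
    filter_upwards [hint] with x hx
    -- the two resampled points merge into one, because resampling preserves the product law
    have h3 : ∀ y y' : ι → ℝ, t.piecewise (s.piecewise x y) y' =
        (s ∩ t).piecewise x (t.piecewise y y') := fun y y' => by
      ext i
      by_cases hi : i ∈ t <;> by_cases hi' : i ∈ s <;> simp [hi, hi']
    simp only [hG_def, h3]
    rw [← integral_prod (fun z : (ι → ℝ) × (ι → ℝ) => F ((s ∩ t).piecewise x (t.piecewise z.1 z.2)))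
      (hmp.integrable_comp_of_integrable hx)]
    rw [← integral_map (f := fun y => F ((s ∩ t).piecewise x y)) hmp.aemeasurable, hmp.map_eq]
    rw [hmp.map_eq]
    exact hx.aestronglyMeasurable
  univ v := by
    obtain ⟨F, hF, hFv⟩ : ∃ F : (ι → ℝ) → ℝ, Measurable F ∧ v =ᵐ[Measure.pi μ] F :=
      ⟨_, (Lp.stronglyMeasurable v).measurable, Filter.EventuallyEq.rfl⟩
    have hF2 : MemLp F 2 (Measure.pi μ) := (memLp_congr_ae hFv).1 (Lp.memLp v)
    obtain rfl : v = hF2.toLp F := Lp.ext (hFv.trans hF2.coeFn_toLp.symm)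
    exact coordProj_toLp_eq μ _ hF hF2 hF2 fun x => by simp

end ProductSpace

/-! ### Scores and Fisher information of convolutions -/

section Score

/-- Shearing an integrable function of the second variable along the first variable. -/
theorem integrable_comp_sub {ν : Measure ℝ} [IsFiniteMeasure ν] {g : ℝ → ℝ}
    (hg : Integrable g volume) :
    Integrable (fun z : ℝ × ℝ => g (z.2 - z.1)) (ν.prod volume) := by
  have hmp := measurePreserving_prod_neg_add ν (volume : Measure ℝ)
  refine (hmp.integrable_comp_of_integrable (hg.comp_snd ν)).congr (ae_of_all _ fun z => ?_)
  simp [neg_add_eq_sub]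

namespace IsACDensity

variable {p : ℝ → ℝ} {μ : Measure ℝ}

/-- Zeros of a nonnegative function are minima; so the junk value `0` of the score at zeros of the
density is consistent with `score p * p = deriv p`. -/
theorem deriv_eq_zero (h : IsACDensity p μ) {x : ℝ} (hx : p x = 0) : deriv p x = 0 :=
  IsLocalMin.deriv_eq_zero (Filter.Eventually.of_forall fun y => hx ▸ h.nonneg y)

theorem score_mul (h : IsACDensity p μ) (x : ℝ) : score p x * p x = deriv p x := by
  rcases eq_or_ne (p x) 0 with hx | hx
  · rw [hx, mul_zero, h.deriv_eq_zero hx]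
  · rw [score, div_mul_cancel₀ _ hx]

theorem measurable_score (h : IsACDensity p μ) : Measurable (score p) :=
  (measurable_deriv p).div h.continuous.measurable

theorem integral_eq (h : IsACDensity p μ) (φ : ℝ → ℝ) : ∫ x, φ x ∂μ = ∫ x, φ x * p x := by
  rw [h.eq_withDensity, integral_withDensity_eq_integral_toReal_smul
    h.continuous.measurable.ennreal_ofReal (by simp)]
  simp [ENNReal.toReal_ofReal (h.nonneg _), mul_comm]

theorem integrable_iff (h : IsACDensity p μ) {φ : ℝ → ℝ} :
    Integrable φ μ ↔ Integrable fun x => φ x * p x := by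
  rw [h.eq_withDensity, integrable_withDensity_iff h.continuous.measurable.ennreal_ofReal (by simp)]
  simp [ENNReal.toReal_ofReal (h.nonneg _)]

theorem lintegral_eq (h : IsACDensity p μ) {φ : ℝ → ℝ≥0∞} (hφ : Measurable φ) :
    ∫⁻ x, φ x ∂μ = ∫⁻ x, ENNReal.ofReal (p x) * φ x := by
  rw [h.eq_withDensity,
    lintegral_withDensity_eq_lintegral_mul _ h.continuous.measurable.ennreal_ofReal hφ]
  rfl

theorem integrable [IsFiniteMeasure μ] (h : IsACDensity p μ) : Integrable p := by
  simpa using h.integrable_iff.1 (integrable_const (1 : ℝ))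

theorem memLp_score [IsFiniteMeasure μ] (h : IsACDensity p μ) (hI : fisherInfo μ ≠ ∞) :
    MemLp (score p) 2 μ := by
  rw [memLp_two_iff_integrable_sq h.measurable_score.aestronglyMeasurable]
  refine ⟨(h.measurable_score.pow_const 2).aestronglyMeasurable, ?_⟩
  rw [hasFiniteIntegral_iff_ofReal (ae_of_all _ fun x => sq_nonneg _), ← fisherInfo_eq h]
  exact hI.lt_top

theorem fisherInfo_eq_integral [IsFiniteMeasure μ] (h : IsACDensity p μ) (hI : fisherInfo μ ≠ ∞) :
    fisherInfo μ = ENNReal.ofReal (∫ x, score p x ^ 2 ∂μ) := by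
  rw [fisherInfo_eq h, ofReal_integral_eq_lintegral_ofReal (h.memLp_score hI).integrable_sq
    (ae_of_all _ fun x => sq_nonneg _)]

theorem integrable_deriv [IsFiniteMeasure μ] (h : IsACDensity p μ) (hI : fisherInfo μ ≠ ∞) :
    Integrable (deriv p) := by
  have := h.integrable_iff.1 ((h.memLp_score hI).integrable one_le_two)
  simpa only [h.score_mul] using this

theorem integral_deriv [IsFiniteMeasure μ] (h : IsACDensity p μ) (hI : fisherInfo μ ≠ ∞) :
    ∫ x, deriv p x = 0 := by
  have hint := h.integrable_deriv hI
  have : IsFiniteMeasure (volume.restrict (Set.uIoc (0 : ℝ) 1)) := ⟨by simp⟩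
  -- Integrate `p x - p (x - 1) = ∫ u in 0..1, deriv p (x - u)` over `x`.
  have h1 := intervalIntegral_integral_swap (μ := volume) (a := 0) (b := 1)
    (f := fun u x => deriv p (x - u)) (integrable_comp_sub hint)
  simp only [integral_sub_right_eq_self (deriv p), intervalIntegral.integral_const,
    intervalIntegral.integral_comp_sub_left (deriv p),
    (h.absCont _ _).integral_deriv_eq_sub] at h1
  rw [integral_sub (h.integrable.comp_sub_right _) (h.integrable.comp_sub_right _),
    integral_sub_right_eq_self p, integral_sub_right_eq_self p] at h1
  simpa using h1

theorem integral_score [IsFiniteMeasure μ] (h : IsACDensity p μ) (hI : fisherInfo μ ≠ ∞) :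
    ∫ x, score p x ∂μ = 0 := by
  rw [h.integral_eq]
  simp only [h.score_mul]
  exact h.integral_deriv hI

/-- A density with finite Fisher information is bounded, since its derivative is integrable. -/
theorem exists_le [IsFiniteMeasure μ] (h : IsACDensity p μ) (hI : fisherInfo μ ≠ ∞) :
    ∃ B, ∀ x, p x ≤ B := by
  refine ⟨p 0 + ∫ x, ‖deriv p x‖, fun x => ?_⟩
  have h1 := (h.absCont 0 x).integral_deriv_eq_sub
  have h2 : ‖∫ u in (0 : ℝ)..x, deriv p u‖ ≤ ∫ u, ‖deriv p u‖ :=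
    intervalIntegral.norm_integral_le_integral_norm_uIoc.trans
      (setIntegral_le_integral (h.integrable_deriv hI).norm (ae_of_all _ fun _ => norm_nonneg _))
  rw [h1, Real.norm_eq_abs] at h2
  linarith [le_abs_self (p x - p 0)]

variable {ν : Measure ℝ} [IsProbabilityMeasure ν] [IsProbabilityMeasure μ]

theorem integrable_comp_sub_left (h : IsACDensity p μ) (hI : fisherInfo μ ≠ ∞) (z : ℝ) :
    Integrable (fun y => p (z - y)) ν := by
  obtain ⟨B, hB⟩ := h.exists_le hI
  refine Integrable.of_bound (h.continuous.comp (by fun_prop)).aestronglyMeasurable B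
    (ae_of_all _ fun y => ?_)
  rw [Real.norm_eq_abs, abs_of_nonneg (h.nonneg _)]
  exact hB _

theorem integrable_integral_deriv (h : IsACDensity p μ) (hI : fisherInfo μ ≠ ∞) :
    Integrable (fun z => ∫ y, deriv p (z - y) ∂ν) :=
  (integrable_comp_sub (ν := ν) (h.integrable_deriv hI)).integral_prod_right

theorem integral_comp_sub_eq (h : IsACDensity p μ) (hI : fisherInfo μ ≠ ∞) (a b : ℝ) :
    ∫ y, p (b - y) ∂ν = ∫ y, p (a - y) ∂ν + ∫ u in a..b, ∫ y, deriv p (u - y) ∂ν := by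
  rw [intervalIntegral_integral_swap]
  · simp only [intervalIntegral.integral_comp_sub_right (deriv p),
      (h.absCont _ _).integral_deriv_eq_sub]
    rw [integral_sub (h.integrable_comp_sub_left hI _) (h.integrable_comp_sub_left hI _)]
    ring
  · have := (integrable_comp_sub (ν := ν) (h.integrable_deriv hI)).swap
    rw [← Measure.restrict_univ (μ := ν), Measure.prod_restrict]
    exact this.integrableOn

/-- Convolving with an arbitrary law preserves absolute continuity of a density with finite Fisher
information. -/
theorem conv (h : IsACDensity p μ) (hI : fisherInfo μ ≠ ∞) :
    IsACDensity (fun z => ∫ y, p (z - y) ∂ν) (μ ∗ ν) where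
  nonneg z := integral_nonneg fun y => h.nonneg _
  absCont a b := by
    have h1 := ((h.integrable_integral_deriv hI (ν := ν)).intervalIntegrable (a := a)
      (b := b)).absolutelyContinuousOnInterval_intervalIntegral (c := a) (by simp)
    have h2 : AbsolutelyContinuousOnInterval (fun _ : ℝ => ∫ y, p (a - y) ∂ν) a b :=
      contDiffOn_const.absolutelyContinuousOnInterval
    rw [funext fun z => h.integral_comp_sub_eq (ν := ν) hI a z]
    exact h2.add h1
  eq_withDensity := by
    refine Measure.ext_of_lintegral _ fun φ hφ => ?_
    have hp : Measurable fun x => ENNReal.ofReal (p x) := h.continuous.measurable.ennreal_ofReal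
    have hm : Measurable fun z : ℝ × ℝ => ENNReal.ofReal (p (z.2 - z.1)) * φ z.2 :=
      (hp.comp (by fun_prop)).mul (hφ.comp measurable_snd)
    have hf : ∀ z, ENNReal.ofReal (∫ y, p (z - y) ∂ν) = ∫⁻ y, ENNReal.ofReal (p (z - y)) ∂ν :=
      fun z => ofReal_integral_eq_lintegral_ofReal (h.integrable_comp_sub_left hI z)
        (ae_of_all _ fun y => h.nonneg _)
    simp only [hf]
    rw [lintegral_withDensity_eq_lintegral_mul _ (by
      exact (hp.comp (by fun_prop : Measurable fun z : ℝ × ℝ => z.2 - z.1)).lintegral_prod_left') hφ,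
      Measure.conv_comm, Measure.lintegral_conv hφ]
    calc ∫⁻ y, (∫⁻ x, φ (y + x) ∂μ) ∂ν
        = ∫⁻ y, (∫⁻ z, ENNReal.ofReal (p (z - y)) * φ z) ∂ν := by
          refine lintegral_congr fun y => ?_
          rw [h.lintegral_eq (φ := fun x => φ (y + x)) (hφ.comp (by fun_prop)),
            ← lintegral_sub_right_eq_self _ y]
          simp
      _ = ∫⁻ z, (∫⁻ y, ENNReal.ofReal (p (z - y)) * φ z ∂ν) := lintegral_lintegral_swap hm.aemeasurable
      _ = _ := by
          refine lintegral_congr fun z => ?_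
          exact lintegral_mul_const _ (hp.comp (by fun_prop : Measurable fun y : ℝ => z - y))

theorem deriv_conv (h : IsACDensity p μ) (hI : fisherInfo μ ≠ ∞) :
    ∀ᵐ z, deriv (fun z => ∫ y, p (z - y) ∂ν) z = ∫ y, deriv p (z - y) ∂ν := by
  filter_upwards [LocallyIntegrable.ae_hasDerivAt_integral (h.integrable_integral_deriv hI
    (ν := ν)).locallyIntegrable] with z hz
  have h1 := (hz 0).const_add (∫ y, p (0 - y) ∂ν)
  refine (h1.congr_of_eventuallyEq (Filter.Eventually.of_forall fun b => ?_)).deriv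
  exact h.integral_comp_sub_eq hI 0 b

/-- Adding an independent random variable does not increase the Fisher information. -/
theorem fisherInfo_conv_le (h : IsACDensity p μ) (hI : fisherInfo μ ≠ ∞) :
    fisherInfo (μ ∗ ν) ≤ fisherInfo μ := by
  have hf := h.conv hI (ν := ν)
  set f := fun z => ∫ y, p (z - y) ∂ν with hf_def
  have hp : Measurable fun x => ENNReal.ofReal (p x) := h.continuous.measurable.ennreal_ofReal
  have hs : Measurable fun x => ENNReal.ofReal (score p x ^ 2) :=
    (h.measurable_score.pow_const 2).ennreal_ofReal
  have hG : Measurable fun x => ENNReal.ofReal (p x) * ENNReal.ofReal (score p x ^ 2) := hp.mul hs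
  have hpt : ∀ᵐ z, ENNReal.ofReal (f z) * ENNReal.ofReal (score f z ^ 2) ≤
      ∫⁻ y, ENNReal.ofReal (p (z - y)) * ENNReal.ofReal (score p (z - y) ^ 2) ∂ν := by
    filter_upwards [h.deriv_conv hI (ν := ν)] with z hz
    rcases eq_or_ne (f z) 0 with h0 | h0
    · simp [h0]
    have hpos : 0 < f z := lt_of_le_of_ne (hf.nonneg z) (Ne.symm h0)
    set A := ∫⁻ y, ENNReal.ofReal (p (z - y)) * ENNReal.ofReal (score p (z - y) ^ 2) ∂ν with hA
    have hB : ∫⁻ y, ENNReal.ofReal (p (z - y)) ∂ν = ENNReal.ofReal (f z) :=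
      (ofReal_integral_eq_lintegral_ofReal (h.integrable_comp_sub_left hI z)
        (ae_of_all _ fun y => h.nonneg _)).symm
    -- Cauchy-Schwarz for `deriv p = (score p * √p) * √p`
    have hCS := ENNReal.lintegral_mul_le_Lp_mul_Lq ν Real.HolderConjugate.two_two
      (f := fun y => ENNReal.ofReal (√(p (z - y)) * |score p (z - y)|))
      (g := fun y => ENNReal.ofReal (√(p (z - y))))
      (by
        have h1 : Measurable fun x => ENNReal.ofReal (√(p x) * |score p x|) :=
          (h.continuous.measurable.sqrt.mul h.measurable_score.abs).ennreal_ofReal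
        exact (h1.comp (by fun_prop : Measurable fun y : ℝ => z - y)).aemeasurable)
      (by
        have h1 : Measurable fun x => ENNReal.ofReal (√(p x)) :=
          h.continuous.measurable.sqrt.ennreal_ofReal
        exact (h1.comp (by fun_prop : Measurable fun y : ℝ => z - y)).aemeasurable)
    have e1 : ∀ y, ENNReal.ofReal (√(p (z - y)) * |score p (z - y)|) ^ (2 : ℝ) =
        ENNReal.ofReal (p (z - y)) * ENNReal.ofReal (score p (z - y) ^ 2) := fun y => by
      rw [ENNReal.rpow_two, ← ENNReal.ofReal_pow (by positivity), mul_pow,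
        Real.sq_sqrt (h.nonneg _), sq_abs, ENNReal.ofReal_mul (h.nonneg _)]
    have e2 : ∀ y, ENNReal.ofReal (√(p (z - y))) ^ (2 : ℝ) = ENNReal.ofReal (p (z - y)) :=
      fun y => by
        rw [ENNReal.rpow_two, ← ENNReal.ofReal_pow (by positivity), Real.sq_sqrt (h.nonneg _)]
    have e3 : ∀ y, ((fun y => ENNReal.ofReal (√(p (z - y)) * |score p (z - y)|)) *
        fun y => ENNReal.ofReal (√(p (z - y)))) y = ‖deriv p (z - y)‖ₑ := fun y => by
      rw [Pi.mul_apply, ← ENNReal.ofReal_mul (by positivity), ← h.score_mul,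
        ← ofReal_norm, norm_mul, Real.norm_eq_abs, Real.norm_eq_abs,
        abs_of_nonneg (h.nonneg _), mul_right_comm, Real.mul_self_sqrt (h.nonneg _), mul_comm]
    simp only [e1, e2, e3, hB, ← hA] at hCS
    have h2 : ENNReal.ofReal (deriv f z ^ 2) ≤ A * ENNReal.ofReal (f z) := by
      have h3 : ‖deriv f z‖ₑ ≤ A ^ (1 / 2 : ℝ) * ENNReal.ofReal (f z) ^ (1 / 2 : ℝ) := by
        rw [hz]
        exact (enorm_integral_le_lintegral_enorm _).trans hCS
      have h4 := ENNReal.rpow_le_rpow h3 (zero_le_two : (0 : ℝ) ≤ 2)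
      rw [ENNReal.mul_rpow_of_nonneg _ _ zero_le_two, ← ENNReal.rpow_mul, ← ENNReal.rpow_mul] at h4
      norm_num at h4
      rwa [← ofReal_norm, ← ENNReal.ofReal_pow (norm_nonneg _), Real.norm_eq_abs,
        sq_abs] at h4
    have h5 : ENNReal.ofReal (f z) * ENNReal.ofReal (score f z ^ 2) =
        ENNReal.ofReal (deriv f z ^ 2) / ENNReal.ofReal (f z) := by
      rw [← ENNReal.ofReal_mul hpos.le, ← ENNReal.ofReal_div_of_pos hpos, score]
      congr 1
      field_simp
    rw [h5]
    exact ENNReal.div_le_of_le_mul h2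
  rw [fisherInfo_eq hf, fisherInfo_eq h, h.lintegral_eq hs,
    hf.lintegral_eq (hf.measurable_score.pow_const 2).ennreal_ofReal]
  refine (lintegral_mono_ae hpt).trans (le_of_eq ?_)
  rw [lintegral_lintegral_swap (f := fun z y => ENNReal.ofReal (p (z - y)) *
    ENNReal.ofReal (score p (z - y) ^ 2))
    (hG.comp (by fun_prop : Measurable fun z : ℝ × ℝ => z.1 - z.2)).aemeasurable]
  have h6 : ∀ y, ∫⁻ z, ENNReal.ofReal (p (z - y)) * ENNReal.ofReal (score p (z - y) ^ 2) =
      ∫⁻ z, ENNReal.ofReal (p z) * ENNReal.ofReal (score p z ^ 2) := fun y =>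
    lintegral_sub_right_eq_self (fun z => ENNReal.ofReal (p z) * ENNReal.ofReal (score p z ^ 2)) y
  simp [h6]

/-- The score of a sum is the conditional expectation, given the sum, of the score of a summand;
here tested against square-integrable functions of the sum. -/
theorem integral_score_mul_comp_add (h : IsACDensity p μ) (hI : fisherInfo μ ≠ ∞) {φ : ℝ → ℝ}
    (hφ2 : MemLp φ 2 (μ ∗ ν)) :
    ∫ z, score p z.2 * φ (z.1 + z.2) ∂(ν.prod μ) =
      ∫ u, score (fun z => ∫ y, p (z - y) ∂ν) u * φ u ∂(μ ∗ ν) := by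
  have hf := h.conv hI (ν := ν)
  have hmp : MeasurePreserving (fun z : ℝ × ℝ => z.1 + z.2) (ν.prod μ) (μ ∗ ν) :=
    ⟨by fun_prop, by rw [Measure.conv_comm, Measure.conv]⟩
  have hint : Integrable (fun z : ℝ × ℝ => score p z.2 * φ (z.1 + z.2)) (ν.prod μ) :=
    ((h.memLp_score hI).comp_measurePreserving measurePreserving_snd).integrable_mul
      (hφ2.comp_measurePreserving hmp)
  have hint2 : Integrable (fun z : ℝ × ℝ => deriv p (z.2 - z.1) * φ z.2) (ν.prod volume) := by
    have h1 := hint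
    have h2 : ν.prod μ = (ν.prod volume).withDensity fun z => ENNReal.ofReal (p z.2) := by
      conv_lhs => rw [h.eq_withDensity]
      exact prod_withDensity_right h.continuous.measurable.ennreal_ofReal
    have h3 : Measurable fun z : ℝ × ℝ => ENNReal.ofReal (p z.2) :=
      h.continuous.measurable.ennreal_ofReal.comp measurable_snd
    rw [h2, integrable_withDensity_iff h3 (by simp)] at h1
    refine ((measurePreserving_prod_neg_add ν (volume : Measure ℝ)).integrable_comp_of_integrable
      h1).congr (ae_of_all _ fun z => ?_)
    simp only [Function.comp, ENNReal.toReal_ofReal (h.nonneg _), neg_add_eq_sub, add_sub_cancel]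
    rw [mul_right_comm, h.score_mul]
  calc ∫ z, score p z.2 * φ (z.1 + z.2) ∂(ν.prod μ)
      = ∫ y, (∫ x, score p x * φ (y + x) ∂μ) ∂ν := integral_prod _ hint
    _ = ∫ y, (∫ z, deriv p (z - y) * φ z) ∂ν := by
        refine integral_congr_ae (ae_of_all _ fun y => ?_)
        dsimp only
        rw [h.integral_eq, ← integral_sub_right_eq_self _ y]
        refine integral_congr_ae (ae_of_all _ fun z => ?_)
        dsimp only
        rw [mul_right_comm, h.score_mul, add_sub_cancel]
    _ = ∫ z, (∫ y, deriv p (z - y) * φ z ∂ν) := integral_integral_swap hint2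
    _ = _ := by
        rw [hf.integral_eq]
        refine integral_congr_ae ?_
        filter_upwards [h.deriv_conv hI (ν := ν)] with z hz
        rw [integral_mul_const, mul_right_comm, hf.score_mul, hz]

/-- An absolutely continuous density has positive Fisher information: a vanishing score would make
it constant. -/
theorem fisherInfo_ne_zero (h : IsACDensity p μ) : fisherInfo μ ≠ 0 := by
  intro h0
  rw [fisherInfo_eq h, lintegral_eq_zero_iff (h.measurable_score.pow_const 2).ennreal_ofReal,
    h.eq_withDensity, Filter.EventuallyEq,
    ae_withDensity_iff h.continuous.measurable.ennreal_ofReal] at h0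
  have hd : ∀ᵐ x, deriv p x = 0 := by
    filter_upwards [h0] with x hx
    rcases eq_or_ne (p x) 0 with hp | hp
    · exact h.deriv_eq_zero hp
    have h1 := hx (by simpa using lt_of_le_of_ne (h.nonneg x) (Ne.symm hp))
    have h2 : score p x ^ 2 ≤ 0 := by simpa using h1
    rw [← h.score_mul, pow_eq_zero_iff two_ne_zero |>.1 (le_antisymm h2 (sq_nonneg _)), zero_mul]
  have hc : ∀ x, p x = p 0 := fun x => by
    have h1 := (h.absCont 0 x).integral_deriv_eq_sub
    rw [intervalIntegral.integral_congr_ae (g := fun _ => (0 : ℝ))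
      (by filter_upwards [hd] with u hu _ using hu)] at h1
    simp only [intervalIntegral.integral_zero] at h1
    linarith
  have h1 := h.integrable
  rw [show p = fun _ => p 0 from funext hc, integrable_const_iff] at h1
  rcases h1 with h1 | h1
  · have h2 : μ Set.univ = 0 := by
      rw [h.eq_withDensity, show p = fun _ => p 0 from funext hc, h1]
      simp
    simp at h2
  · exact absurd h1.1 (by simp)

end IsACDensity
end Score

/-! ### Rigidity: additively split scores are Gaussian -/

section Rigidity

open Filter Topology Set
open scoped Pointwise

/-- A continuous function that is additive near `0` is linear near `0`. -/
theorem exists_eq_mul_of_add {r : ℝ → ℝ} (hr : Continuous r) {η : ℝ} (hη : 0 < η)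
    (hadd : ∀ s t, |s| ≤ η → |t| ≤ η → r (s + t) = r s + r t) :
    ∃ k, ∀ t, |t| < η → r t = k * t := by
  set F : ℝ → ℝ := fun t => ∫ s in (0 : ℝ)..t, r s with hF
  have hFd : ∀ t, HasDerivAt F (r t) t := fun t => hr.integral_hasStrictDerivAt 0 t |>.hasDerivAt
  have hint : ∀ a b, IntervalIntegrable r volume a b := fun a b => hr.intervalIntegrable a b
  -- Integrating the additivity relation exhibits `r` as a difference of primitives.
  have h1 : ∀ t, |t| < η → r t = (F (t + η) - F t - F η) / η := by
    intro t ht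
    have h2 : ∫ s in (0 : ℝ)..η, r (s + t) = ∫ s in (0 : ℝ)..η, (r s + r t) := by
      refine intervalIntegral.integral_congr fun s hs => ?_
      rw [uIcc_of_le hη.le] at hs
      exact hadd s t (abs_le.2 ⟨by linarith [hs.1], hs.2⟩) ht.le
    have h3 : ∫ s in (0 + t)..(η + t), r s = F (t + η) - F t := by
      rw [hF, zero_add, add_comm η t]
      exact (intervalIntegral.integral_interval_sub_left (hint _ _) (hint _ _)).symm
    rw [intervalIntegral.integral_comp_add_right r, intervalIntegral.integral_add (hint _ _)
      (by simp), intervalIntegral.integral_const, h3, sub_zero, smul_eq_mul] at h2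
    rw [h2]
    field_simp
    simp only [hF]
    ring
  have h2 : ∀ t ∈ Metric.ball (0 : ℝ) η, HasDerivAt (fun t => r t - r η / η * t) 0 t := by
    intro t ht
    have ht' : |t| < η := by simpa using ht
    have h3 : HasDerivAt (fun t => (F (t + η) - F t - F η) / η) ((r (t + η) - r t) / η) t := by
      have := ((((hFd (t + η)).comp_add_const t η).sub (hFd t)).sub_const (F η)).div_const η
      exact this
    have h4 : HasDerivAt r ((r (t + η) - r t) / η) t := by
      refine h3.congr_of_eventuallyEq ?_
      filter_upwards [Metric.isOpen_ball.mem_nhds ht] with u hu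
      exact h1 u (by simpa using hu)
    refine (h4.sub ((hasDerivAt_id t).const_mul (r η / η))).congr_deriv ?_
    rw [hadd t η ht'.le (abs_of_pos hη).le]
    ring
  have hr0 : r 0 = 0 := by
    have := hadd 0 0 (by simpa using hη.le) (by simpa using hη.le)
    simpa using this
  refine ⟨r η / η, fun t ht => ?_⟩
  have h5 := Metric.isOpen_ball.is_const_of_deriv_eq_zero (convex_ball (0 : ℝ) η).isPreconnected
    (fun t ht => (h2 t ht).differentiableAt.differentiableWithinAt)
    (fun t ht => (h2 t ht).deriv) (show t ∈ Metric.ball (0 : ℝ) η by simpa using ht)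
    (Metric.mem_ball_self hη)
  rw [hr0] at h5
  linarith

/-- A continuous function whose increments `q (x + s) - q x` are affine in `x` near `0`, for all
small `s`, is a quadratic polynomial near `0`. -/
theorem exists_eq_quadratic {q : ℝ → ℝ} (hq : Continuous q) {δ : ℝ} (hδ : 0 < δ) {β : ℝ → ℝ}
    (h : ∀ s t, |s| < δ → |t| < δ → q (t + s) - q s - q t + q 0 = β s * t) :
    ∃ a b c, ∀ᶠ t in 𝓝 0, q t = a * t ^ 2 + b * t + c := by
  have hsymm : ∀ s t, |s| < δ → |t| < δ → β s * t = β t * s := fun s t hs ht => by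
    rw [← h s t hs ht, ← h t s ht hs, add_comm t s]; ring
  set c := β (δ / 2) / (δ / 2) with hc
  have hδ2 : |δ / 2| < δ := by rw [abs_of_pos (by positivity)]; linarith
  have hβ : ∀ s, |s| < δ → β s = c * s := fun s hs => by
    have := hsymm s (δ / 2) hs hδ2
    rw [hc]; field_simp; linarith
  obtain ⟨k, hk⟩ := exists_eq_mul_of_add (r := fun t => q t - q 0 - c / 2 * t ^ 2)
    (by fun_prop) (half_pos hδ) (fun s t hs ht => by
      have h1 := h t s (by linarith) (by linarith)
      rw [hβ t (by linarith)] at h1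
      linarith)
  refine ⟨c / 2, k, q 0, ?_⟩
  filter_upwards [Metric.ball_mem_nhds (0 : ℝ) (half_pos hδ)] with t ht
  have := hk t (by simpa using ht)
  linarith

namespace IsACDensity

variable {f : ℝ → ℝ} {μ : Measure ℝ}

/-- Where an absolutely continuous density is positive, its score is the derivative of its
logarithm. -/
theorem integral_score_interval (hf : IsACDensity f μ) {a b : ℝ} (hpos : ∀ x ∈ uIcc a b, 0 < f x) :
    IntervalIntegrable (score f) volume a b ∧
      ∫ x in a..b, score f x = Real.log (f b) - Real.log (f a) := by
  have hcont := hf.continuous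
  obtain ⟨x₀, hx₀, hmin⟩ := isCompact_uIcc.exists_isMinOn nonempty_uIcc (hcont.continuousOn (s := uIcc a b))
  obtain ⟨x₁, hx₁, hmax⟩ := isCompact_uIcc.exists_isMaxOn nonempty_uIcc (hcont.continuousOn (s := uIcc a b))
  have hlog : ContDiffOn ℝ 1 Real.log (Icc (f x₀) (f x₁)) := fun u hu =>
    (Real.contDiffAt_log.2 ((hpos x₀ hx₀).trans_le hu.1).ne').contDiffWithinAt
  obtain ⟨K, hK⟩ := hlog.exists_lipschitzOnWith (by decide) (convex_Icc _ _) isCompact_Icc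
  have hAC : AbsolutelyContinuousOnInterval (fun x => Real.log (f x)) a b := by
    rw [absolutelyContinuousOnInterval_iff]
    intro ε hε
    obtain ⟨δ, hδ, h⟩ := (absolutelyContinuousOnInterval_iff f a b).1 (hf.absCont a b)
      (ε / (K + 1)) (by positivity)
    refine ⟨δ, hδ, fun E hE hEδ => ?_⟩
    have hmem : ∀ x ∈ uIcc a b, f x ∈ Icc (f x₀) (f x₁) := fun x hx => ⟨hmin hx, hmax hx⟩
    calc ∑ i ∈ Finset.range E.1, dist (Real.log (f (E.2 i).1)) (Real.log (f (E.2 i).2))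
        ≤ ∑ i ∈ Finset.range E.1, (K + 1) * dist (f (E.2 i).1) (f (E.2 i).2) := by
          refine Finset.sum_le_sum fun i hi => ?_
          have h1 := hK.dist_le_mul _ (hmem _ (hE.1 i hi).1) _ (hmem _ (hE.1 i hi).2)
          exact h1.trans (by gcongr; linarith)
      _ = (K + 1) * ∑ i ∈ Finset.range E.1, dist (f (E.2 i).1) (f (E.2 i).2) := by
          rw [Finset.mul_sum]
      _ < (K + 1) * (ε / (K + 1)) := by gcongr; exact h E hE hEδ
      _ = ε := by field_simp
  have hd : ∀ᵐ x, x ∈ uIoc a b → deriv (fun x => Real.log (f x)) x = score f x := by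
    filter_upwards [(hf.absCont a b).ae_differentiableAt] with x hx hxab
    have hx' := uIoc_subset_uIcc hxab
    exact ((hx hx').hasDerivAt.log (hpos x hx').ne').deriv
  refine ⟨hAC.intervalIntegrable_deriv.congr_ae ?_, ?_⟩
  · rw [EventuallyEq, ae_restrict_iff' measurableSet_uIoc]
    exact hd
  · rw [← hAC.integral_deriv_eq_sub]
    exact intervalIntegral.integral_congr_ae (by filter_upwards [hd] with x hx hxab using (hx hxab).symm)

end IsACDensity

/-- A continuous density that is locally the exponential of a quadratic polynomial wherever it is
positive is globally so. -/
theorem exists_eq_exp_quadratic {f : ℝ → ℝ} (hf : Continuous f) {z₀ : ℝ} (hz₀ : 0 < f z₀)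
    (h : ∀ z, 0 < f z → ∃ a b c, ∀ᶠ u in 𝓝 z, f u = Real.exp (a * u ^ 2 + b * u + c)) :
    ∃ a b c, ∀ u, f u = Real.exp (a * u ^ 2 + b * u + c) := by
  have hquad : ∀ a b c : ℝ, AnalyticOnNhd ℝ (fun u => a * u ^ 2 + b * u + c) univ :=
    fun a b c u _ => by fun_prop
  obtain ⟨a, b, c, habc⟩ := h z₀ hz₀
  refine ⟨a, b, c, ?_⟩
  set S := {z | ∀ᶠ u in 𝓝 z, f u = Real.exp (a * u ^ 2 + b * u + c)} with hS
  have hopen : IsOpen S := isOpen_setOfPred_eventually_nhds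
  have hclosed : IsClosed S := by
    refine isClosed_of_closure_subset fun z hz => ?_
    have hz1 : f z = Real.exp (a * z ^ 2 + b * z + c) := by
      have hcl : IsClosed {z | f z = Real.exp (a * z ^ 2 + b * z + c)} :=
        isClosed_eq hf (by fun_prop)
      exact closure_minimal (fun w (hw : w ∈ S) => hw.self_of_nhds) hcl hz
    obtain ⟨a', b', c', hz2⟩ := h z (hz1 ▸ Real.exp_pos _)
    obtain ⟨w, hw1, hw2⟩ := ((mem_closure_iff_frequently.1 hz).and_eventually
      hz2.eventually_nhds).exists
    have heq : (fun u : ℝ => a * u ^ 2 + b * u + c) = fun u => a' * u ^ 2 + b' * u + c' := by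
      refine AnalyticOnNhd.eq_of_eventuallyEq (𝕜 := ℝ) (z₀ := w)
        (hquad a b c) (hquad a' b' c') ?_
      filter_upwards [hw1, hw2] with u h1 h2
      exact Real.exp_injective (h1.symm.trans h2)
    filter_upwards [hz2] with u hu
    rw [hu]
    exact congrArg Real.exp (congrFun heq u).symm
  have huniv : S = univ := IsClopen.eq_univ ⟨hclosed, hopen⟩ ⟨z₀, habc⟩
  intro u
  have : u ∈ S := huniv ▸ mem_univ u
  exact this.self_of_nhds

/-- A probability density that is the exponential of a quadratic polynomial is Gaussian. -/
theorem exists_eq_gaussianReal_of_exp_quadratic {f : ℝ → ℝ} {μ : Measure ℝ} [IsProbabilityMeasure μ]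
    (hf : IsACDensity f μ) {a b c : ℝ} (h : ∀ u, f u = Real.exp (a * u ^ 2 + b * u + c)) :
    ∃ (m : ℝ) (v : ℝ≥0), v ≠ 0 ∧ μ = gaussianReal m v := by
  have ha : a < 0 := by
    by_contra! ha
    have hint := hf.integrable
    have key : ∀ s : Set ℝ, MeasurableSet s → (∀ x ∈ s, 0 ≤ b * x) → volume s = ∞ → False := by
      intro s hs hb hvol
      have h1 : IntegrableOn (fun _ : ℝ => Real.exp c) s := by
        refine Integrable.mono' hint.integrableOn (by fun_prop) ?_
        rw [ae_restrict_iff' hs]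
        refine ae_of_all _ fun x hx => ?_
        rw [h, Real.norm_eq_abs, abs_of_pos (Real.exp_pos _)]
        exact Real.exp_le_exp.2 (by nlinarith [hb x hx, mul_nonneg ha (sq_nonneg x)])
      rw [integrableOn_const_iff] at h1
      rcases h1 with h1 | h1
      · exact (Real.exp_pos c).ne' (by simp at h1)
      · exact h1.ne hvol
    -- on one of the half-lines the density is bounded below by `exp c`
    rcases le_total 0 b with hb | hb
    · exact key (Ici 0) measurableSet_Ici (fun x hx => mul_nonneg hb hx) Real.volume_Ici
    · exact key (Iic 0) measurableSet_Iic (fun x hx => mul_nonneg_of_nonpos_of_nonpos hb hx) Real.volume_Iic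
  have ha' : a ≠ 0 := ha.ne
  -- completing the square
  set v : ℝ≥0 := (-(1 / (2 * a))).toNNReal with hv
  have hvpos : 0 < -(1 / (2 * a)) := by
    rw [neg_pos]; exact div_neg_of_pos_of_neg one_pos (by linarith)
  have hv' : (v : ℝ) = -(1 / (2 * a)) := Real.coe_toNNReal _ hvpos.le
  have hv0 : v ≠ 0 := by rw [hv]; exact (Real.toNNReal_pos.2 hvpos).ne'
  set m := -(b / (2 * a)) with hm
  set K := √(2 * Real.pi * v) * Real.exp (c - b ^ 2 / (4 * a)) with hK
  have hK0 : 0 ≤ K := by positivity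
  have hsq : √(2 * Real.pi * v) ≠ 0 := by
    rw [hv']; positivity
  have hfK : ∀ x, f x = K * gaussianPDFReal m v x := by
    intro x
    rw [gaussianPDFReal, hK, mul_mul_mul_comm, mul_inv_cancel₀ hsq, one_mul, ← Real.exp_add, h]
    congr 1
    rw [hv', hm]
    field_simp
    ring
  have hμ : μ = ENNReal.ofReal K • gaussianReal m v := by
    rw [hf.eq_withDensity, gaussianReal_of_var_ne_zero _ hv0,
      ← withDensity_smul _ (measurable_gaussianPDF m v)]
    congr 1
    ext x
    rw [hfK, ENNReal.ofReal_mul hK0]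
    rfl
  have hK1 : ENNReal.ofReal K = 1 := by
    have := congrArg (fun μ : Measure ℝ => μ univ) hμ
    simpa using this.symm
  exact ⟨m, v, hv0, by rw [hμ, hK1, one_smul]⟩

namespace IsACDensity
variable {p : ℝ → ℝ} {μ ν : Measure ℝ} [IsProbabilityMeasure μ] [IsProbabilityMeasure ν]

/-- The density of a sum is positive at sums of a point where the first density is positive and a
point of the support of the second law. -/
theorem integral_comp_sub_pos (h : IsACDensity p μ) (hI : fisherInfo μ ≠ ∞) {x y : ℝ}
    (hx : 0 < p x) (hy : y ∈ ν.support) : 0 < ∫ y', p (x + y - y') ∂ν := by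
  rw [integral_pos_iff_support_of_nonneg (fun y' => h.nonneg _) (h.integrable_comp_sub_left hI _)]
  refine (Measure.mem_support_iff_forall y).1 hy _ ?_
  have hc : ContinuousAt (fun y' => p (x + y - y')) y :=
    (h.continuous.comp (by fun_prop)).continuousAt
  exact hc.eventually_ne (by simpa using hx.ne')

/-- **Rigidity**: if the score of the sum of two independent random variables splits as a sum of a
function of the first and a function of the second, then the sum is normally distributed. -/
theorem exists_eq_gaussianReal_of_score_eq_add (h : IsACDensity p μ) (hI : fisherInfo μ ≠ ∞)
    (hν : ν ≪ volume) {g k : ℝ → ℝ}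
    (hsplit : ∀ᵐ z ∂ν.prod μ, score (fun z => ∫ y, p (z - y) ∂ν) (z.1 + z.2) = g z.2 + k z.1) :
    ∃ (m : ℝ) (v : ℝ≥0), v ≠ 0 ∧ μ ∗ ν = gaussianReal m v := by
  have hf := h.conv hI (ν := ν)
  set f := fun z => ∫ y, p (z - y) ∂ν with hf_def
  have hgood : ∀ᵐ y ∂ν, (∀ᵐ x, 0 < p x → score f (y + x) = g x + k y) ∧ y ∈ ν.support := by
    filter_upwards [Measure.ae_ae_of_ae_prod hsplit, Measure.support_mem_ae] with y hy hy'
    refine ⟨?_, hy'⟩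
    rw [h.eq_withDensity, ae_withDensity_iff h.continuous.measurable.ennreal_ofReal] at hy
    filter_upwards [hy] with x hx hpx
    exact hx (by simpa using hpx)
  obtain ⟨N, hN, hNm, hN0⟩ := exists_measurable_superset_of_null (ae_iff.1 hgood)
  have hB : ∀ y ∉ N, (∀ᵐ x, 0 < p x → score f (y + x) = g x + k y) ∧ y ∈ ν.support := by
    intro y hy
    by_contra hc
    exact hy (hN hc)
  have hNpos : 0 < volume Nᶜ := by
    rw [pos_iff_ne_zero]
    intro h0
    have := hν h0
    rw [prob_compl_eq_one_sub hNm, hN0] at this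
    simp at this
  -- two translates of `log f` differ by an affine function on intervals where `p > 0`
  have hlog : ∀ y₀ ∉ N, ∀ y ∉ N, ∀ a b, (∀ x ∈ uIcc a b, 0 < p x) →
      Real.log (f (b + y)) - Real.log (f (a + y)) =
        Real.log (f (b + y₀)) - Real.log (f (a + y₀)) + (k y - k y₀) * (b - a) := by
    intro y₀ hy₀ y hy a b hab
    have key : ∀ y ∉ N, IntervalIntegrable (fun x => score f (x + y)) volume a b ∧
        ∫ x in a..b, score f (x + y) = Real.log (f (b + y)) - Real.log (f (a + y)) := by
      intro y hy
      obtain ⟨h1, h2⟩ := hf.integral_score_interval (a := a + y) (b := b + y) (fun u hu => by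
        have hu' : u - y ∈ uIcc a b := by
          rw [← preimage_sub_const_uIcc] at hu
          exact hu
        have := h.integral_comp_sub_pos (ν := ν) hI (hab _ hu') (hB y hy).2
        simpa [hf_def] using this)
      refine ⟨by simpa using h1.comp_add_right y, ?_⟩
      rw [intervalIntegral.integral_comp_add_right (score f), h2]
    obtain ⟨i1, e1⟩ := key y hy
    obtain ⟨i2, e2⟩ := key y₀ hy₀
    rw [← e1, ← e2, ← sub_eq_iff_eq_add', ← intervalIntegral.integral_sub i1 i2]
    rw [intervalIntegral.integral_congr_ae (g := fun _ => k y - k y₀)]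
    · simp only [intervalIntegral.integral_const, smul_eq_mul]
      ring
    · filter_upwards [(hB y hy).1, (hB y₀ hy₀).1] with x h1 h2 hx
      have hpx := hab x (uIoc_subset_uIcc hx)
      rw [add_comm x, add_comm x, h1 hpx, h2 hpx]
      ring
  have hsteinhaus : Nᶜ - Nᶜ ∈ 𝓝 (0 : ℝ) :=
    Measure.sub_mem_nhds_zero_of_addHaar_pos volume _ hNm.compl hNpos
  have hlocal : ∀ z, 0 < f z → ∃ a b c, ∀ᶠ u in 𝓝 z, f u = Real.exp (a * u ^ 2 + b * u + c) := by
    intro z hz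
    obtain ⟨y₀, hy₀, hpy₀⟩ : ∃ y₀ ∉ N, 0 < p (z - y₀) := by
      by_contra! hc
      refine hz.ne' (integral_eq_zero_of_ae ?_)
      filter_upwards [measure_eq_zero_iff_ae_notMem.1 hN0] with y hy
      exact le_antisymm (hc y hy) (h.nonneg _)
    set x₀ := z - y₀ with hx₀
    have hev : ∀ᶠ t in 𝓝 (0 : ℝ), 0 < p (x₀ + t) ∧ f z / 2 < f (z + t) ∧ t ∈ Nᶜ - Nᶜ := by
      refine Filter.Eventually.and ?_ (Filter.Eventually.and ?_ hsteinhaus)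
      · have hc : ContinuousAt (fun t => p (x₀ + t)) 0 := (h.continuous.comp (by fun_prop)).continuousAt
        exact hc.eventually (lt_mem_nhds (by simpa using hpy₀))
      · have hc : ContinuousAt (fun t => f (z + t)) 0 := (hf.continuous.comp (by fun_prop)).continuousAt
        exact hc.eventually (lt_mem_nhds (by simpa using hz))
    obtain ⟨δ, hδ, hball⟩ := Metric.eventually_nhds_iff.1 hev
    simp only [dist_zero_right, Real.norm_eq_abs] at hball
    have hpI : ∀ a b, |a - x₀| < δ → |b - x₀| < δ → ∀ x ∈ uIcc a b, 0 < p x := by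
      intro a b ha hb x hx
      have hx' : x ∈ Metric.ball x₀ δ :=
        (convex_ball x₀ δ).ordConnected.uIcc_subset ha hb hx
      simpa using (hball (y := x - x₀) (by simpa [Real.dist_eq] using hx')).1
    -- `x ↦ log f (x + s) - log f x` is affine for `s = y' - y`: the argument `x + s + y` equals
    -- `x + y'`, so both translates give its increments.
    have hslope : ∀ s, |s| < δ / 2 → ∃ β, ∀ t, |t| < δ / 2 →
        Real.log (f (z + (t + s))) - Real.log (f (z + s)) -
          Real.log (f (z + t)) + Real.log (f (z + 0)) = β * t := by
      intro s hs
      have hsδ : |s| < δ := by linarith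
      obtain ⟨y', hy', y, hy, hyy⟩ := (hball hsδ).2.2
      refine ⟨k y' - k y, fun t ht => ?_⟩
      have hs' : s = y' - y := hyy.symm
      have e1 := hlog y₀ hy₀ y hy (x₀ + s) (x₀ + (t + s))
        (hpI _ _ (by simpa using hsδ) (by
          rw [add_sub_cancel_left]; exact (abs_add_le t s).trans_lt (by linarith)))
      have e2 := hlog y₀ hy₀ y' hy' x₀ (x₀ + t)
        (hpI _ _ (by simpa using hδ) (by rw [add_sub_cancel_left]; linarith))
      have a1 : x₀ + (t + s) + y = x₀ + t + y' := by rw [hs']; ring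
      have a2 : x₀ + s + y = x₀ + y' := by rw [hs']; ring
      have b1 : x₀ + (t + s) + y₀ = z + (t + s) := by rw [hx₀]; ring
      have b2 : x₀ + s + y₀ = z + s := by rw [hx₀]; ring
      have b3 : x₀ + t + y₀ = z + t := by rw [hx₀]; ring
      have b4 : x₀ + y₀ = z + 0 := by rw [hx₀]; ring
      rw [a1, a2, b1, b2] at e1
      rw [b3, b4] at e2
      linear_combination e2 - e1
    choose! β hβ using hslope
    -- truncating `f` from below makes its logarithm continuous everywhere
    obtain ⟨a, b, c, habc⟩ := exists_eq_quadratic (q := fun t => Real.log (max (f (z + t)) (f z / 2)))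
      (δ := δ / 2) (β := β)
      (Continuous.log (by have := hf.continuous; fun_prop) fun t =>
        (lt_max_of_lt_right (half_pos hz)).ne') (half_pos hδ) (fun s t hs ht => by
        have hm : ∀ t, |t| < δ → max (f (z + t)) (f z / 2) = f (z + t) := fun t ht =>
          max_eq_left (hball ht).2.1.le
        have hts : |t + s| < δ := (abs_add_le t s).trans_lt (by linarith)
        rw [hm _ hts, hm s (by linarith), hm t (by linarith), hm 0 (by simpa using hδ)]
        exact hβ s hs t ht)
    refine ⟨a, b - 2 * a * z, a * z ^ 2 - b * z + c, ?_⟩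
    have htend : Tendsto (fun u => u - z) (𝓝 z) (𝓝 0) := by
      have : ContinuousAt (fun u => u - z) z := by fun_prop
      simpa [ContinuousAt] using this
    filter_upwards [htend.eventually habc, htend.eventually hev] with u hu1 hu2
    rw [add_sub_cancel] at hu1 hu2
    rw [max_eq_left hu2.2.1.le] at hu1
    rw [← Real.exp_log ((half_pos hz).trans hu2.2.1), hu1]
    congr 1
    ring
  have hpos : ∃ z₀, 0 < f z₀ := by
    by_contra! hc
    have h0 : ∀ z, f z = 0 := fun z => le_antisymm (hc z) (hf.nonneg z)
    have h1 : (μ ∗ ν) univ = 0 := by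
      rw [hf.eq_withDensity]; simp [h0]
    simp at h1
  obtain ⟨z₀, hz₀⟩ := hpos
  obtain ⟨a, b, c, habc⟩ := exists_eq_exp_quadratic hf.continuous hz₀ hlocal
  exact exists_eq_gaussianReal_of_exp_quadratic hf habc

end IsACDensity
end Rigidity

/-! ### Cramér's decomposition theorem -/

section Cramer

open Filter Topology

/-- An entire function whose real part grows at most quadratically is a quadratic polynomial. -/
theorem eq_quadratic_of_re_le {g : ℂ → ℂ} (hg : Differentiable ℂ g) (h0 : g 0 = 0) {A : ℝ}
    (hA : 0 < A) (h : ∀ z, (g z).re ≤ A * (1 + ‖z‖ ^ 2)) :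
    ∃ a b : ℂ, ∀ z, g z = a * z + b * z ^ 2 := by
  have hbound : ∀ z, ‖g z‖ ≤ 2 * (A * (1 + (2 * ‖z‖) ^ 2)) := by
    intro z
    rcases eq_or_ne z 0 with rfl | hz
    · simp [h0, hA.le]
    have hz' : 0 < ‖z‖ := norm_pos_iff.2 hz
    have hb := Complex.borelCaratheodory_zero (f := g) (M := A * (1 + (2 * ‖z‖) ^ 2))
      (R := 2 * ‖z‖) (z := z) (by positivity) hg.differentiableOn
      (fun w hw => by
        have hw' : ‖w‖ < 2 * ‖z‖ := by simpa using hw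
        exact (h w).trans (by gcongr))
      (by positivity) (by simpa using by linarith) h0
    refine hb.trans (le_of_eq ?_)
    have : 2 * ‖z‖ - ‖z‖ = ‖z‖ := by ring
    rw [this, mul_div_assoc, div_self hz'.ne', mul_one]
  have h3 : ∀ c, iteratedDeriv 3 g c = 0 := by
    intro c
    have hR : ∀ R : ℝ, 0 < R → ‖iteratedDeriv 3 g c‖ ≤
        (Nat.factorial 3) * (2 * (A * (1 + (2 * (‖c‖ + R)) ^ 2))) / R ^ 3 := by
      intro R hR
      refine Complex.norm_iteratedDeriv_le_of_forall_mem_sphere_norm_le 3 hR hg.diffContOnCl ?_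
      intro z hz
      have hz' : ‖z‖ ≤ ‖c‖ + R := by
        have : ‖z - c‖ = R := by simpa [mem_sphere_iff_norm] using hz
        calc ‖z‖ = ‖c + (z - c)‖ := by ring_nf
          _ ≤ ‖c‖ + R := this ▸ norm_add_le _ _
      exact (hbound z).trans (by gcongr)
    have hlim : Tendsto (fun R : ℝ => (Nat.factorial 3 : ℝ) *
        (2 * (A * (1 + (2 * (‖c‖ + R)) ^ 2))) / R ^ 3) atTop (𝓝 0) := by
      have hinv : Tendsto (fun R : ℝ => R⁻¹) atTop (𝓝 0) := tendsto_inv_atTop_zero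
      have : Tendsto (fun R : ℝ => (Nat.factorial 3 : ℝ) *
          (2 * (A * (R⁻¹ ^ 2 + (2 * (‖c‖ * R⁻¹ + 1)) ^ 2))) * R⁻¹) atTop
          (𝓝 ((Nat.factorial 3 : ℝ) * (2 * (A * (0 ^ 2 + (2 * (‖c‖ * 0 + 1)) ^ 2))) * 0)) := by
        exact (tendsto_const_nhds.mul (tendsto_const_nhds.mul (tendsto_const_nhds.mul
          ((hinv.pow 2).add ((tendsto_const_nhds.mul
            ((tendsto_const_nhds.mul hinv).add tendsto_const_nhds)).pow 2))))).mul hinv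
      rw [mul_zero] at this
      refine this.congr' ?_
      filter_upwards [eventually_gt_atTop 0] with R hR
      field_simp
    have := ge_of_tendsto hlim ((eventually_gt_atTop 0).mono hR)
    exact norm_le_zero_iff.1 this
  have hg1 : Differentiable ℂ (deriv g) := hg.deriv
  have hg2 : Differentiable ℂ (deriv (deriv g)) := hg1.deriv
  have h3' : ∀ c, deriv (deriv (deriv g)) c = 0 := fun c => by
    have := h3 c
    simpa [iteratedDeriv_succ, iteratedDeriv_zero] using this
  set b := deriv (deriv g) 0
  have e2 : ∀ z, deriv (deriv g) z = b := fun z => is_const_of_deriv_eq_zero hg2 h3' z 0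
  set a := deriv g 0 with ha
  have e1 : ∀ z, deriv g z = a + b * z := by
    intro z
    have hd : ∀ z, HasDerivAt (fun z => deriv g z - b * z) 0 z := fun z => by
      have := (hg1 z).hasDerivAt.sub ((hasDerivAt_id z).const_mul b)
      exact this.congr_deriv (by rw [e2, mul_one, sub_self])
    have := is_const_of_deriv_eq_zero (fun z => (hd z).differentiableAt) (fun z => (hd z).deriv) z 0
    simp only [mul_zero, sub_zero] at this
    rw [ha, ← this]
    ring
  refine ⟨a, b / 2, fun z => ?_⟩
  have hd : ∀ z, HasDerivAt (fun z => g z - (a * z + b / 2 * z ^ 2)) 0 z := fun z => by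
    have := (hg z).hasDerivAt.sub (((hasDerivAt_id z).const_mul a).add
      ((hasDerivAt_pow 2 z).const_mul (b / 2)))
    refine this.congr_deriv ?_
    rw [e1]
    simp
    ring
  have := is_const_of_deriv_eq_zero (fun z => (hd z).differentiableAt) (fun z => (hd z).deriv) z 0
  simp only [h0] at this
  linear_combination this

/-- An entire function without zeros has an entire logarithm. -/
theorem exists_entire_log {φ : ℂ → ℂ} (hφ : Differentiable ℂ φ) (hne : ∀ z, φ z ≠ 0)
    (h0 : φ 0 = 1) : ∃ g : ℂ → ℂ, Differentiable ℂ g ∧ g 0 = 0 ∧ ∀ z, φ z = Complex.exp (g z) := by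
  have hd : Differentiable ℂ fun z => deriv φ z / φ z := hφ.deriv.div hφ hne
  obtain ⟨g, hg0, hg⟩ := hd.isExactOn_univ.with_val_at 0 0
  have hg' : ∀ z, HasDerivAt g (deriv φ z / φ z) z := fun z => hg z (Set.mem_univ z)
  refine ⟨g, fun z => (hg' z).differentiableAt, hg0, fun z => ?_⟩
  have hq : ∀ z, HasDerivAt (fun z => φ z * Complex.exp (-g z)) 0 z := fun z => by
    refine ((hφ z).hasDerivAt.mul (hg' z).neg.cexp).congr_deriv ?_
    have := hne z
    field_simp
    ring
  have := is_const_of_deriv_eq_zero (fun z => (hq z).differentiableAt) (fun z => (hq z).deriv) z 0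
  simp only [h0, hg0, neg_zero, Complex.exp_zero, mul_one, Complex.exp_neg] at this
  field_simp at this
  exact this

/-- If a sum of independent variables has an exponential moment, so does each summand: by Fubini it
is finite for a translate of the summand. -/
theorem integrable_exp_of_conv {μ ν : Measure ℝ} [IsProbabilityMeasure μ] [IsProbabilityMeasure ν]
    {t : ℝ} (h : Integrable (fun x => Real.exp (t * x)) (μ ∗ ν)) :
    Integrable (fun x => Real.exp (t * x)) ν := by
  rw [Measure.conv, integrable_map_measure (by fun_prop) (by fun_prop)] at h
  obtain ⟨x, hx⟩ := h.prod_right_ae.exists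
  refine (hx.const_mul (Real.exp (-(t * x)))).congr (ae_of_all _ fun y => ?_)
  simp only [Function.comp, ← Real.exp_add]
  ring_nf

/-- Jensen's inequality for the moment generating function. -/
theorem exp_mul_integral_le_mgf {ν : Measure ℝ} [IsProbabilityMeasure ν]
    (hν : integrableExpSet id ν = Set.univ) (t : ℝ) :
    Real.exp (t * ∫ y, y ∂ν) ≤ mgf id ν t := by
  have hint : Integrable (fun y : ℝ => y) ν := by
    have := memLp_of_mem_interior_integrableExpSet (X := id) (μ := ν) (by simp [hν]) 1
    exact memLp_one_iff_integrable.1 (by rwa [ENNReal.coe_one] at this)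
  have ht : Integrable (fun y : ℝ => Real.exp (t * y)) ν := by
    have : t ∈ integrableExpSet id ν := by simp [hν]
    exact this
  set e := ∫ y, y ∂ν
  have hlin : Integrable (fun y => t * y - t * e) ν := (hint.const_mul t).sub (integrable_const _)
  have h1 : ∫ y, (1 + (t * y - t * e)) ∂ν = 1 := by
    rw [integral_add (integrable_const 1) hlin,
      integral_sub (hint.const_mul t) (integrable_const _), integral_const_mul]
    simp [e]
  have h2 : ∫ y, (1 + (t * y - t * e)) ∂ν ≤ ∫ y, Real.exp (-(t * e)) * Real.exp (t * y) ∂ν := by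
    refine integral_mono ((integrable_const 1).add hlin)
      (ht.const_mul _) fun y => ?_
    dsimp only
    rw [← Real.exp_add]
    have := Real.add_one_le_exp (-(t * e) + t * y)
    linarith
  rw [h1, integral_const_mul] at h2
  have h3 : mgf id ν t = ∫ y, Real.exp (t * y) ∂ν := rfl
  rw [h3]
  have h4 := mul_le_mul_of_nonneg_left h2 (Real.exp_pos (t * e)).le
  rwa [← mul_assoc, ← Real.exp_add, add_neg_cancel, Real.exp_zero, one_mul, mul_one] at h4

/-- **Cramér's decomposition theorem**: if the sum of two independent random variables is normally
distributed, then so is each of them. -/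
theorem exists_eq_gaussianReal_of_conv_eq {μ ν : Measure ℝ} [IsProbabilityMeasure μ]
    [IsProbabilityMeasure ν] {m : ℝ} {v : ℝ≥0} (h : μ ∗ ν = gaussianReal m v) :
    ∃ (m' : ℝ) (v' : ℝ≥0), μ = gaussianReal m' v' := by
  have hν : integrableExpSet id ν = Set.univ := Set.eq_univ_of_forall fun t =>
    integrable_exp_of_conv (μ := μ) (h ▸ integrable_exp_mul_gaussianReal t)
  have hμ : integrableExpSet id μ = Set.univ := Set.eq_univ_of_forall fun t =>
    integrable_exp_of_conv (μ := ν) (Measure.conv_comm μ ν ▸ h ▸ integrable_exp_mul_gaussianReal t)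
  have hprod : ∀ z : ℂ, complexMGF id μ z * complexMGF id ν z =
      Complex.exp (z * m + v * z ^ 2 / 2) := by
    intro z
    rw [← complexMGF_id_gaussianReal, ← h, complexMGF, complexMGF, complexMGF, ← integral_prod_mul,
      Measure.conv, integral_map (by fun_prop) (by fun_prop)]
    refine integral_congr_ae (ae_of_all _ fun p => ?_)
    simp only [id, ← Complex.exp_add]
    push_cast
    ring_nf
  have hdiff : Differentiable ℂ (complexMGF id μ) := by
    rw [← differentiableOn_univ]
    simpa [hμ] using differentiableOn_complexMGF (X := id) (μ := μ)
  have hne : ∀ z, complexMGF id μ z ≠ 0 := fun z hz => by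
    have := hprod z
    rw [hz, zero_mul] at this
    exact Complex.exp_ne_zero _ this.symm
  obtain ⟨g, hg, hg0, hexp⟩ := exists_entire_log hdiff hne (by simp [complexMGF])
  set e := ∫ y, y ∂ν
  -- `|φ z| ≤ φ (re z)`, and the moment generating function of the other summand is at least
  -- `exp (e * re z)`, which bounds `re g` by the exponent of the Gaussian plus a linear term.
  have hre : ∀ z, (g z).re ≤ (|m - e| + v + 1) * (1 + ‖z‖ ^ 2) := by
    intro z
    have h1 : Real.exp (g z).re ≤ mgf id μ z.re := by
      rw [← Complex.norm_exp, ← hexp]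
      exact norm_complexMGF_le_mgf
    have h2 : mgf id μ z.re * mgf id ν z.re = Real.exp (z.re * m + v * z.re ^ 2 / 2) := by
      have := hprod z.re
      rw [complexMGF_ofReal, complexMGF_ofReal] at this
      exact_mod_cast this
    have h3 := exp_mul_integral_le_mgf hν z.re
    have h4 : Real.exp ((g z).re + z.re * e) ≤ Real.exp (z.re * m + v * z.re ^ 2 / 2) := by
      rw [Real.exp_add, ← h2]
      gcongr
      exact mgf_nonneg
    have h5 := Real.exp_le_exp.1 h4
    have h6 : |z.re| ≤ ‖z‖ := Complex.abs_re_le_norm z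
    have h7 : z.re ^ 2 ≤ ‖z‖ ^ 2 := by
      rw [← sq_abs z.re]; gcongr
    have h8 : z.re * (m - e) ≤ ‖z‖ * |m - e| := by
      refine (le_abs_self _).trans ?_
      rw [abs_mul]; gcongr
    have h9 : ‖z‖ ≤ 1 + ‖z‖ ^ 2 := by nlinarith [sq_nonneg (‖z‖ - 1), norm_nonneg z]
    have h10 := mul_le_mul_of_nonneg_right h9 (abs_nonneg (m - e))
    have hv : (0 : ℝ) ≤ v := v.2
    nlinarith [mul_le_mul_of_nonneg_left h7 hv, sq_nonneg ‖z‖]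
  obtain ⟨a, b, hab⟩ := eq_quadratic_of_re_le hg hg0 (by positivity) hre
  -- On the real axis `φ` is positive, so only the real parts of the coefficients matter.
  have hmgf : ∀ t : ℝ, mgf id μ t = Real.exp (a.re * t + b.re * t ^ 2) := by
    intro t
    have h1 := congrArg norm (hexp t)
    rw [complexMGF_ofReal, Complex.norm_exp, Complex.norm_real, Real.norm_eq_abs,
      abs_of_nonneg mgf_nonneg, hab] at h1
    rw [h1, ← Complex.ofReal_pow, Complex.add_re, Complex.re_mul_ofReal, Complex.re_mul_ofReal]
  -- Otherwise `exp (a t + b t²)` would violate the Jensen bound for `t → ±∞`; `t = ±1` suffices.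
  have hb : 0 ≤ b.re := by
    set d := (∫ y, y ∂μ) - a.re
    have h1 : ∀ t : ℝ, t * d ≤ b.re * t ^ 2 := fun t => by
      have := exp_mul_integral_le_mgf hμ t
      rw [hmgf] at this
      have := Real.exp_le_exp.1 this
      simp only [d]
      linarith
    have h2 := h1 1
    have h3 := h1 (-1)
    linarith
  refine ⟨a.re, (2 * b.re).toNNReal, ?_⟩
  refine Measure.ext_of_complexMGF_id_eq ?_
  have := eqOn_complexMGF_of_mgf (X := id) (μ := μ) (Y := id)
    (μ' := gaussianReal a.re (2 * b.re).toNNReal) (by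
      ext t
      rw [hmgf, mgf_id_gaussianReal]
      rw [Real.coe_toNNReal _ (by positivity)]
      ring_nf)
  ext z
  exact this (by simp [hμ])

end Cramer

/-! ### Subset sums of independent variables -/

section SubsetSums

variable {ι : Type*} [Fintype ι]

/-- The law of the sum of the coordinates in `s` under the product of the laws `μ i`. -/
noncomputable def coordSumLaw (μ : ι → Measure ℝ) (s : Finset ι) : Measure ℝ :=
  (Measure.pi μ).map fun x => ∑ i ∈ s, x i

theorem measurePreserving_coordSum (μ : ι → Measure ℝ) (s : Finset ι) :
    MeasurePreserving (fun x : ι → ℝ => ∑ i ∈ s, x i) (Measure.pi μ) (coordSumLaw μ s) :=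
  ⟨by fun_prop, rfl⟩

theorem measurable_score_coordSum {μ : ι → Measure ℝ} {p : ℝ → ℝ} {s : Finset ι}
    (hp : IsACDensity p (coordSumLaw μ s)) :
    Measurable fun x : ι → ℝ => score p (∑ i ∈ s, x i) :=
  hp.measurable_score.comp (by fun_prop)

variable (μ : ι → Measure ℝ) [∀ i, IsProbabilityMeasure (μ i)]

instance (s : Finset ι) : IsProbabilityMeasure (coordSumLaw μ s) :=
  Measure.isProbabilityMeasure_map (by fun_prop)

theorem coordSumLaw_singleton (i : ι) : coordSumLaw μ {i} = μ i := by
  simpa [coordSumLaw] using (measurePreserving_eval μ i).map_eq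

theorem not_isACDensity_coordSumLaw_empty {p : ℝ → ℝ} : ¬ IsACDensity p (coordSumLaw μ ∅) := by
  intro h
  have h1 : coordSumLaw μ ∅ ≪ volume := by
    rw [h.eq_withDensity]
    exact withDensity_absolutelyContinuous _ _
  have h2 := h1 (show volume {(0 : ℝ)} = 0 by simp)
  simp [coordSumLaw] at h2

open Classical in
/-- The score of a density `f`, evaluated at the sum of the coordinates in `s`, as an element of
`L²` of the product law; `0` if it is not square-integrable. -/
noncomputable def scoreVec (f : ℝ → ℝ) (s : Finset ι) : Lp ℝ 2 (Measure.pi μ) :=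
  if h : MemLp (fun x : ι → ℝ => score f (∑ i ∈ s, x i)) 2 (Measure.pi μ) then h.toLp else 0

variable {μ} {p f : ℝ → ℝ} {s : Finset ι}

theorem memLp_score_coordSum (hp : IsACDensity p (coordSumLaw μ s))
    (hI : fisherInfo (coordSumLaw μ s) ≠ ∞) :
    MemLp (fun x : ι → ℝ => score p (∑ i ∈ s, x i)) 2 (Measure.pi μ) :=
  (hp.memLp_score hI).comp_measurePreserving (measurePreserving_coordSum μ s)

theorem norm_scoreVec_sq (hp : IsACDensity p (coordSumLaw μ s))
    (hI : fisherInfo (coordSumLaw μ s) ≠ ∞) :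
    ‖scoreVec μ p s‖ ^ 2 = ∫ x, score p x ^ 2 ∂coordSumLaw μ s := by
  have hm := memLp_score_coordSum hp hI
  rw [← real_inner_self_eq_norm_sq, scoreVec, dif_pos hm, L2.inner_def,
    ← (measurePreserving_coordSum μ s).map_eq,
    integral_map (by fun_prop) (hp.measurable_score.pow_const 2).aestronglyMeasurable]
  refine integral_congr_ae ?_
  filter_upwards [hm.coeFn_toLp] with x hx
  rw [hx]
  simp [sq]

theorem ofReal_norm_scoreVec_sq (hp : IsACDensity p (coordSumLaw μ s))
    (hI : fisherInfo (coordSumLaw μ s) ≠ ∞) :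
    ENNReal.ofReal (‖scoreVec μ p s‖ ^ 2) = fisherInfo (coordSumLaw μ s) := by
  rw [norm_scoreVec_sq hp hI, hp.fisherInfo_eq_integral hI]

variable (μ) [DecidableEq ι]

/-- Sums over disjoint sets of coordinates are independent. -/
theorem measurePreserving_coordSum_prodMk {s t : Finset ι} (h : Disjoint s t) :
    MeasurePreserving (fun x : ι → ℝ => (∑ i ∈ s, x i, ∑ i ∈ t, x i)) (Measure.pi μ)
      ((coordSumLaw μ s).prod (coordSumLaw μ t)) := by
  refine ⟨by fun_prop, ?_⟩
  have hmp := measurePreserving_piecewise μ s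
  rw [← ((measurePreserving_coordSum μ s).prod (measurePreserving_coordSum μ t)).map_eq]
  conv_lhs => rw [← hmp.map_eq]
  rw [Measure.map_map (by fun_prop) hmp.measurable]
  congr 1
  ext z : 1
  simp only [Function.comp, sum_piecewise_left, sum_piecewise_right h, Prod.map]

theorem coordSumLaw_conv {s t : Finset ι} (h : Disjoint s t) :
    coordSumLaw μ s ∗ coordSumLaw μ t = coordSumLaw μ (s ∪ t) := by
  rw [Measure.conv, ← (measurePreserving_coordSum_prodMk μ h).map_eq,
    Measure.map_map (by fun_prop) (by fun_prop), coordSumLaw]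
  congr 1
  ext x
  simp [Function.comp, Finset.sum_union h]

theorem coordSumLaw_conv_compl (s : Finset ι) :
    coordSumLaw μ s ∗ coordSumLaw μ sᶜ = coordSumLaw μ Finset.univ := by
  rw [coordSumLaw_conv μ disjoint_compl_right, Finset.union_compl]

theorem coordSumLaw_absolutelyContinuous (hμ : ∀ i, μ i ≪ volume) {s : Finset ι}
    (hs : s.Nonempty) : coordSumLaw μ s ≪ volume := by
  obtain ⟨i, hi⟩ := hs
  rw [← Finset.insert_erase hi, Finset.insert_eq, Finset.union_comm, ← coordSumLaw_conv,
    coordSumLaw_singleton]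
  · exact Measure.conv_absolutelyContinuous (hμ i)
  · simp

variable {μ}

theorem coordProj_scoreVec (hp : IsACDensity p (coordSumLaw μ s))
    (hI : fisherInfo (coordSumLaw μ s) ≠ ∞) :
    coordProj μ s (scoreVec μ p s) = scoreVec μ p s := by
  have hm := memLp_score_coordSum hp hI
  rw [scoreVec, dif_pos hm]
  exact coordProj_toLp_eq μ s (measurable_score_coordSum hp) hm hm
    fun x => by simp [sum_piecewise_left]

theorem coordProj_empty_scoreVec (hp : IsACDensity p (coordSumLaw μ s))
    (hI : fisherInfo (coordSumLaw μ s) ≠ ∞) :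
    coordProj μ ∅ (scoreVec μ p s) = 0 := by
  have hm := memLp_score_coordSum hp hI
  rw [scoreVec, dif_pos hm, coordProj_toLp_eq μ ∅ (measurable_score_coordSum hp) hm
    (MemLp.zero' (ε := ℝ)) fun x => ?_]
  · exact MemLp.toLp_zero _
  · simp only [Finset.piecewise_empty]
    rw [← hp.integral_score hI, ← (measurePreserving_coordSum μ s).map_eq,
      integral_map (by fun_prop) hp.measurable_score.aestronglyMeasurable]

theorem isACDensity_univ_eq (hp : IsACDensity p (coordSumLaw μ s))
    (hI : fisherInfo (coordSumLaw μ s) ≠ ∞) (hf : IsACDensity f (coordSumLaw μ Finset.univ)) :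
    f = fun z => ∫ y, p (z - y) ∂coordSumLaw μ sᶜ := by
  have h := hp.conv hI (ν := coordSumLaw μ sᶜ)
  rw [coordSumLaw_conv_compl] at h
  exact hf.unique h

/-- The score of the total sum is the projection of the score of a subset sum. -/
theorem inner_scoreVec_univ (hp : IsACDensity p (coordSumLaw μ s))
    (hI : fisherInfo (coordSumLaw μ s) ≠ ∞) (hf : IsACDensity f (coordSumLaw μ Finset.univ))
    (hIf : fisherInfo (coordSumLaw μ Finset.univ) ≠ ∞) :
    inner ℝ (scoreVec μ p s) (scoreVec μ f Finset.univ) = ‖scoreVec μ f Finset.univ‖ ^ 2 := by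
  have hm := memLp_score_coordSum hp hI
  have hmf := memLp_score_coordSum hf hIf
  rw [norm_scoreVec_sq hf hIf, scoreVec, scoreVec, dif_pos hm, dif_pos hmf, L2.inner_def]
  have h1 := hp.integral_score_mul_comp_add hI (ν := coordSumLaw μ sᶜ) (φ := score f)
    (by rw [coordSumLaw_conv_compl]; exact hf.memLp_score hIf)
  rw [← isACDensity_univ_eq hp hI hf, coordSumLaw_conv_compl] at h1
  have hmeas : Measurable fun z : ℝ × ℝ => score p z.2 * score f (z.1 + z.2) :=
    (hp.measurable_score.comp measurable_snd).mul (hf.measurable_score.comp (by fun_prop))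
  simp only [sq]
  rw [← h1, ← (measurePreserving_coordSum_prodMk μ (disjoint_compl_left (a := s))).map_eq,
    integral_map (by fun_prop) hmeas.aestronglyMeasurable]
  refine integral_congr_ae ?_
  filter_upwards [hm.coeFn_toLp, hmf.coeFn_toLp] with x hx hx'
  rw [hx, hx']
  simp [Finset.sum_compl_add_sum, mul_comm]

/-- If the score of the total sum is the sum of its projections on the coordinates in `s` and on
the other coordinates, then the total sum is normally distributed. -/
theorem exists_coordSumLaw_eq_gaussianReal (hμ : ∀ i, μ i ≪ volume)
    (hp : IsACDensity p (coordSumLaw μ s))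
    (hI : fisherInfo (coordSumLaw μ s) ≠ ∞) (hf : IsACDensity f (coordSumLaw μ Finset.univ))
    (hIf : fisherInfo (coordSumLaw μ Finset.univ) ≠ ∞) (hs : s ≠ Finset.univ)
    (h : scoreVec μ f Finset.univ = coordProj μ s (scoreVec μ f Finset.univ) +
      coordProj μ sᶜ (scoreVec μ f Finset.univ)) :
    ∃ (m : ℝ) (v : ℝ≥0), coordSumLaw μ Finset.univ = gaussianReal m v := by
  have hmf := memLp_score_coordSum hf hIf
  have hmeas := measurable_score_coordSum hf
  rw [scoreVec, dif_pos hmf] at h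
  have hg : ∀ t : Finset ι, Measurable fun a : ℝ =>
      ∫ y, score f (a + ∑ i ∈ t, y i) ∂Measure.pi μ := fun t =>
    (hf.measurable_score.comp (by fun_prop : Measurable fun z : ℝ × (ι → ℝ) =>
      z.1 + ∑ i ∈ t, z.2 i)).stronglyMeasurable.integral_prod_right'.measurable
  have hsum : ∀ (t : Finset ι) (x y : ι → ℝ), ∑ i, t.piecewise x y i =
      ∑ i ∈ t, x i + ∑ i ∈ tᶜ, y i := fun t x y => by
    rw [← Finset.sum_add_sum_compl t, sum_piecewise_left, sum_piecewise_right disjoint_compl_right]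
  obtain ⟨g, k, hsplit⟩ : ∃ g k : ℝ → ℝ, ∀ᵐ z ∂(coordSumLaw μ sᶜ).prod (coordSumLaw μ s),
      score f (z.1 + z.2) = g z.2 + k z.1 := by
    refine ⟨fun a => ∫ y, score f (a + ∑ i ∈ sᶜ, y i) ∂Measure.pi μ,
      fun a => ∫ y, score f (a + ∑ i ∈ sᶜᶜ, y i) ∂Measure.pi μ, ?_⟩
    have hset : MeasurableSet {z : ℝ × ℝ | score f (z.1 + z.2) =
        ∫ y, score f (z.2 + ∑ i ∈ sᶜ, y i) ∂Measure.pi μ +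
          ∫ y, score f (z.1 + ∑ i ∈ sᶜᶜ, y i) ∂Measure.pi μ} :=
      measurableSet_eq_fun (hf.measurable_score.comp (by fun_prop))
        (((hg _).comp measurable_snd).add ((hg _).comp measurable_fst))
    rw [← (measurePreserving_coordSum_prodMk μ (disjoint_compl_left (a := s))).map_eq,
      ae_map_iff (by fun_prop) hset]
    have h1 : hmf.toLp =ᵐ[Measure.pi μ] _ := hmf.coeFn_toLp
    rw [h] at h1
    filter_upwards [h1, Lp.coeFn_add (coordProj μ s hmf.toLp) (coordProj μ sᶜ hmf.toLp),
      coordProj_toLp μ s hmeas hmf, coordProj_toLp μ sᶜ hmeas hmf] with x e1 e2 e3 e4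
    rw [e2, Pi.add_apply, e3, e4] at e1
    simp only [hsum] at e1
    rw [Finset.sum_compl_add_sum]
    exact e1.symm
  rw [isACDensity_univ_eq hp hI hf] at hsplit
  obtain ⟨m, v, -, hmv⟩ := hp.exists_eq_gaussianReal_of_score_eq_add hI
    (coordSumLaw_absolutelyContinuous μ hμ (by
      rw [Finset.nonempty_iff_ne_empty, Ne, Finset.compl_eq_empty_iff]; exact hs)) hsplit
  rw [coordSumLaw_conv_compl] at hmv
  exact ⟨m, v, hmv⟩

/-- If the total sum is normal, so is each summand, by Cramér's theorem; the variance is nonzero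
because a Dirac mass has no density. -/
theorem exists_eq_gaussianReal_of_coordSumLaw_univ (hμ : ∀ i, μ i ≪ volume) {m : ℝ} {v : ℝ≥0}
    (h : coordSumLaw μ Finset.univ = gaussianReal m v) (i : ι) :
    ∃ (m' : ℝ) (v' : ℝ≥0), v' ≠ 0 ∧ μ i = gaussianReal m' v' := by
  rw [← coordSumLaw_conv_compl μ {i}, coordSumLaw_singleton] at h
  obtain ⟨m', v', h'⟩ := exists_eq_gaussianReal_of_conv_eq h
  refine ⟨m', v', ?_, h'⟩
  rintro rfl
  have h1 := hμ i (show volume {m'} = 0 by simp)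
  rw [h', gaussianReal_zero_var] at h1
  simp at h1

end SubsetSums

/-! ### The Fisher information inequality and its equality case -/

section FisherInequality

variable {ι : Type*} {C : Finset (Finset ι)} {w : Finset ι → ℝ≥0} {r : ℕ}

/-- A weighted sum of Fisher informations is finite only if every subset sum of positive weight has
finite Fisher information. -/
theorem eq_zero_or_ne_top_of_sum_ne_top {I : Finset ι → ℝ≥0∞} (hr : r ≠ 0)
    (h : (r : ℝ≥0∞) * ∑ s ∈ C, (w s : ℝ≥0∞) ^ 2 * I s ≠ ∞) {s : Finset ι} (hs : s ∈ C) :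
    w s = 0 ∨ I s ≠ ∞ := by
  by_contra! hc
  refine h ?_
  have h1 : (w s : ℝ≥0∞) ^ 2 * I s = ∞ := by
    rw [hc.2]
    exact ENNReal.mul_top (by simpa using hc.1)
  rw [ENNReal.sum_eq_top.2 ⟨s, hs, h1⟩]
  exact ENNReal.mul_top (by exact_mod_cast hr)

theorem exists_mem_ne_zero (hw : ∑ s ∈ C, w s = 1) : ∃ s ∈ C, w s ≠ 0 :=
  Finset.exists_ne_zero_of_sum_ne_zero (by rw [hw]; exact one_ne_zero)

variable [Fintype ι] {μ : ι → Measure ℝ} [∀ i, IsProbabilityMeasure (μ i)]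

theorem ofReal_norm_smul_scoreVec_sq {p : ℝ → ℝ} {s : Finset ι} {w : ℝ≥0}
    (hp : IsACDensity p (coordSumLaw μ s)) (h : w = 0 ∨ fisherInfo (coordSumLaw μ s) ≠ ∞) :
    ENNReal.ofReal (‖(w : ℝ) • scoreVec μ p s‖ ^ 2) =
      (w : ℝ≥0∞) ^ 2 * fisherInfo (coordSumLaw μ s) := by
  rcases h with rfl | hI
  · simp
  · rw [norm_smul, mul_pow, ENNReal.ofReal_mul (by positivity), ofReal_norm_scoreVec_sq hp hI,
      ENNReal.ofReal_pow (norm_nonneg _)]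
    simp

variable {p : Finset ι → ℝ → ℝ} {f : ℝ → ℝ}

theorem ofReal_mul_sum_norm_sq (hp : ∀ s ∈ C, IsACDensity (p s) (coordSumLaw μ s))
    (hI : ∀ s ∈ C, w s = 0 ∨ fisherInfo (coordSumLaw μ s) ≠ ∞) (r : ℕ) :
    ENNReal.ofReal (r * ∑ s ∈ C, ‖(w s : ℝ) • scoreVec μ (p s) s‖ ^ 2) =
      (r : ℝ≥0∞) * ∑ s ∈ C, (w s : ℝ≥0∞) ^ 2 * fisherInfo (coordSumLaw μ s) := by
  rw [ENNReal.ofReal_mul (by positivity), ENNReal.ofReal_natCast,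
    ENNReal.ofReal_sum_of_nonneg fun _ _ => by positivity]
  congr 1
  exact Finset.sum_congr rfl fun s hs => ofReal_norm_smul_scoreVec_sq (hp s hs) (hI s hs)

variable [DecidableEq ι]

theorem inner_sum_smul_scoreVec (hw : ∑ s ∈ C, w s = 1)
    (hp : ∀ s ∈ C, IsACDensity (p s) (coordSumLaw μ s))
    (hI : ∀ s ∈ C, w s = 0 ∨ fisherInfo (coordSumLaw μ s) ≠ ∞)
    (hf : IsACDensity f (coordSumLaw μ Finset.univ))
    (hIf : fisherInfo (coordSumLaw μ Finset.univ) ≠ ∞) :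
    inner ℝ (∑ s ∈ C, (w s : ℝ) • scoreVec μ (p s) s) (scoreVec μ f Finset.univ) =
      ‖scoreVec μ f Finset.univ‖ ^ 2 := by
  have hw' : ∑ s ∈ C, (w s : ℝ) = 1 := by exact_mod_cast hw
  rw [sum_inner, ← one_mul (‖_‖ ^ 2), ← hw', Finset.sum_mul]
  refine Finset.sum_congr rfl fun s hs => ?_
  rw [real_inner_smul_left]
  rcases hI s hs with h0 | hI
  · simp [h0]
  · rw [inner_scoreVec_univ (hp s hs) hI hf hIf]

/-- The score of the total sum is the orthogonal projection of the weighted scores, so their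
distance is given by Pythagoras. -/
theorem norm_sum_smul_scoreVec_sub_sq (hw : ∑ s ∈ C, w s = 1)
    (hp : ∀ s ∈ C, IsACDensity (p s) (coordSumLaw μ s))
    (hI : ∀ s ∈ C, w s = 0 ∨ fisherInfo (coordSumLaw μ s) ≠ ∞)
    (hf : IsACDensity f (coordSumLaw μ Finset.univ))
    (hIf : fisherInfo (coordSumLaw μ Finset.univ) ≠ ∞) :
    ‖∑ s ∈ C, (w s : ℝ) • scoreVec μ (p s) s - scoreVec μ f Finset.univ‖ ^ 2 =
      ‖∑ s ∈ C, (w s : ℝ) • scoreVec μ (p s) s‖ ^ 2 - ‖scoreVec μ f Finset.univ‖ ^ 2 := by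
  rw [norm_sub_sq_real, inner_sum_smul_scoreVec hw hp hI hf hIf]
  ring

theorem coordProj_smul_scoreVec {p : ℝ → ℝ} {s : Finset ι} {w : ℝ≥0}
    (hp : IsACDensity p (coordSumLaw μ s)) (h : w = 0 ∨ fisherInfo (coordSumLaw μ s) ≠ ∞) :
    coordProj μ s ((w : ℝ) • scoreVec μ p s) = (w : ℝ) • scoreVec μ p s ∧
      coordProj μ ∅ ((w : ℝ) • scoreVec μ p s) = 0 := by
  rcases h with rfl | hI
  · simp
  · rw [map_smul, map_smul, coordProj_scoreVec hp hI, coordProj_empty_scoreVec hp hI, smul_zero]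
    exact ⟨rfl, rfl⟩

theorem fisherInfo_coordSumLaw_univ_ne_top (hw : ∑ s ∈ C, w s = 1)
    (hp : ∀ s ∈ C, IsACDensity (p s) (coordSumLaw μ s))
    (hI : ∀ s ∈ C, w s = 0 ∨ fisherInfo (coordSumLaw μ s) ≠ ∞) :
    HasACDensity (coordSumLaw μ Finset.univ) ∧ fisherInfo (coordSumLaw μ Finset.univ) ≠ ∞ := by
  obtain ⟨s, hs, hws⟩ := exists_mem_ne_zero hw
  have hIs := (hI s hs).resolve_left hws
  rw [← coordSumLaw_conv_compl μ s]
  exact ⟨⟨_, (hp s hs).conv hIs⟩, ((hp s hs).fisherInfo_conv_le hIs).trans_lt hIs.lt_top |>.ne⟩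

/-- The Fisher information inequality for subset sums, on a product space. -/
theorem fisherInfo_coordSumLaw_univ_le (hw : ∑ s ∈ C, w s = 1)
    (hp : ∀ s ∈ C, IsACDensity (p s) (coordSumLaw μ s))
    (hr : ∀ i, (C.filter fun s => i ∈ s).card ≤ r) (hr0 : r ≠ 0) :
    fisherInfo (coordSumLaw μ Finset.univ) ≤
      (r : ℝ≥0∞) * ∑ s ∈ C, (w s : ℝ≥0∞) ^ 2 * fisherInfo (coordSumLaw μ s) := by
  by_cases htop : (r : ℝ≥0∞) * ∑ s ∈ C, (w s : ℝ≥0∞) ^ 2 * fisherInfo (coordSumLaw μ s) = ∞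
  · rw [htop]; exact le_top
  have hI := fun s hs => eq_zero_or_ne_top_of_sum_ne_top hr0 htop (s := s) hs
  obtain ⟨⟨f, hf⟩, hIf⟩ := fisherInfo_coordSumLaw_univ_ne_top hw hp hI
  have h1 := norm_sum_smul_scoreVec_sub_sq hw hp hI hf hIf
  have h2 := (isCoordProj_coordProj μ).norm_sum_sq_le
    (fun s hs => (coordProj_smul_scoreVec (hp s hs) (hI s hs)).1)
    (fun s hs => (coordProj_smul_scoreVec (hp s hs) (hI s hs)).2) hr
  have h3 := sq_nonneg ‖∑ s ∈ C, (w s : ℝ) • scoreVec μ (p s) s - scoreVec μ f Finset.univ‖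
  rw [← ofReal_norm_scoreVec_sq hf hIf]
  refine (ENNReal.ofReal_le_ofReal (by linarith : _ ≤ _)).trans (le_of_eq
    (ofReal_mul_sum_norm_sq hp hI r))

/-- Equality in the Fisher information inequality for a discriminating collection forces the total
sum to be normal. -/
theorem coordSumLaw_univ_eq_gaussianReal_of_eq (hμ : ∀ i, μ i ≪ volume) (hw : ∑ s ∈ C, w s = 1)
    (hp : ∀ s ∈ C, IsACDensity (p s) (coordSumLaw μ s))
    (hr : ∀ i, (C.filter fun s => i ∈ s).card ≤ r) (hr0 : r ≠ 0) [Nontrivial ι]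
    (hC : ∀ i j : ι, i ≠ j → ∃ s ∈ C, i ∈ s ∧ j ∉ s)
    (hfin : fisherInfo (coordSumLaw μ Finset.univ) ≠ ∞)
    (heq : fisherInfo (coordSumLaw μ Finset.univ) =
      (r : ℝ≥0∞) * ∑ s ∈ C, (w s : ℝ≥0∞) ^ 2 * fisherInfo (coordSumLaw μ s)) :
    ∃ (m : ℝ) (v : ℝ≥0), coordSumLaw μ Finset.univ = gaussianReal m v := by
  have hI := fun s hs => eq_zero_or_ne_top_of_sum_ne_top hr0 (heq ▸ hfin) (s := s) hs
  obtain ⟨⟨f, hf⟩, hIf⟩ := fisherInfo_coordSumLaw_univ_ne_top hw hp hI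
  have h1 := norm_sum_smul_scoreVec_sub_sq hw hp hI hf hIf
  have hU := fun s hs => (coordProj_smul_scoreVec (hp s hs) (hI s hs)).1
  have hU0 := fun s hs => (coordProj_smul_scoreVec (hp s hs) (hI s hs)).2
  have h2 := (isCoordProj_coordProj μ).norm_sum_sq_le hU hU0 hr
  have h3 := sq_nonneg ‖∑ s ∈ C, (w s : ℝ) • scoreVec μ (p s) s - scoreVec μ f Finset.univ‖
  have h4 : ‖scoreVec μ f Finset.univ‖ ^ 2 =
      r * ∑ s ∈ C, ‖(w s : ℝ) • scoreVec μ (p s) s‖ ^ 2 := by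
    exact (ENNReal.ofReal_eq_ofReal_iff (sq_nonneg _)
      (mul_nonneg r.cast_nonneg (Finset.sum_nonneg fun _ _ => sq_nonneg _))).1
      ((ofReal_norm_scoreVec_sq hf hIf).trans
        (heq.trans (ofReal_mul_sum_norm_sq hp hI r).symm))
  have h5 : ∑ s ∈ C, (w s : ℝ) • scoreVec μ (p s) s = scoreVec μ f Finset.univ := by
    have h6 : ‖∑ s ∈ C, (w s : ℝ) • scoreVec μ (p s) s - scoreVec μ f Finset.univ‖ ^ 2 = 0 := by
      linarith
    exact sub_eq_zero.1 (norm_eq_zero.1 (pow_eq_zero_iff two_ne_zero |>.1 h6))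
  -- If `univ` carried all the weight, equality would read `I = r * I`, but a discriminating
  -- collection containing `univ` has `r ≥ 2`.
  obtain ⟨s, hs, hws, hsu⟩ : ∃ s ∈ C, w s ≠ 0 ∧ s ≠ Finset.univ := by
    by_contra! hc
    obtain ⟨s, hs, hws⟩ := exists_mem_ne_zero hw
    obtain rfl := hc s hs hws
    have hzero : ∀ t ∈ C, t ≠ Finset.univ → w t = 0 := fun t ht htu => by
      by_contra hwt
      exact htu (hc t ht hwt)
    rw [Finset.sum_eq_single_of_mem _ hs hzero] at hw
    rw [Finset.sum_eq_single_of_mem _ hs fun t ht htu => by simp [hzero t ht htu], hw] at heq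
    obtain ⟨i, j, hij⟩ := exists_pair_ne ι
    obtain ⟨t, ht, hit, hjt⟩ := hC i j hij
    have hcard : 2 ≤ r := by
      refine le_trans ?_ (hr i)
      rw [← Finset.card_pair (fun h : t = Finset.univ => hjt (h ▸ Finset.mem_univ j))]
      refine Finset.card_le_card fun a ha => ?_
      rcases Finset.mem_insert.1 ha with rfl | ha
      · exact Finset.mem_filter.2 ⟨ht, hit⟩
      · rw [Finset.mem_singleton.1 ha]
        exact Finset.mem_filter.2 ⟨hs, Finset.mem_univ i⟩
    have h7 : (1 : ℝ≥0∞) * fisherInfo (coordSumLaw μ Finset.univ) =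
        r * fisherInfo (coordSumLaw μ Finset.univ) := by simpa using heq
    rw [ENNReal.mul_left_inj hf.fisherInfo_ne_zero hIf] at h7
    have h8 : 1 = r := by exact_mod_cast h7
    omega
  refine exists_coordSumLaw_eq_gaussianReal hμ (hp s hs) ((hI s hs).resolve_left hws) hf hIf hsu ?_
  rw [← h5]
  exact (isCoordProj_coordProj μ).sum_eq_add_compl hU hU0 hr (by linarith) hC s

end FisherInequality

theorem proposition2 {Ω : Type*} [MeasurableSpace Ω] (P : Measure Ω) [IsProbabilityMeasure P]
    {n : ℕ} (X : Fin n → Ω → ℝ)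
    (hdens : ∀ i, HasPDF (X i) P volume)
    (hvar : ∀ i, MemLp (X i) 2 P)
    (hindep : iIndepFun X P)
    (C : Finset (Finset (Fin n)))
    (w : Finset (Fin n) → ℝ≥0) (hw : ∑ s ∈ C, w s = 1)
    (hAC : ∀ s ∈ C, HasACDensity (sumLaw P X s)) :
    fisherInfo (sumLaw P X Finset.univ) ≤
        (maxDegree C : ℝ≥0∞) * ∑ s ∈ C, (w s : ℝ≥0∞) ^ 2 * fisherInfo (sumLaw P X s) ∧
      (2 ≤ n → Discriminating C →
        fisherInfo (sumLaw P X Finset.univ) ≠ ∞ →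
        fisherInfo (sumLaw P X Finset.univ) =
          (maxDegree C : ℝ≥0∞) * ∑ s ∈ C, (w s : ℝ≥0∞) ^ 2 * fisherInfo (sumLaw P X s) →
        ∀ i, ∃ (m : ℝ) (v : ℝ≥0), v ≠ 0 ∧ P.map (X i) = gaussianReal m v) := by
  classical
  have hXm : ∀ i, AEMeasurable (X i) P := fun i => (hdens i).aemeasurable
  set μ : Fin n → Measure ℝ := fun i => P.map (X i) with hμ_def
  have hμp : ∀ i, IsProbabilityMeasure (μ i) := fun i => Measure.isProbabilityMeasure_map (hXm i)
  have hμ : ∀ i, μ i ≪ volume := fun i => (hdens i).absolutelyContinuous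
  have hlaw : ∀ s, sumLaw P X s = coordSumLaw μ s := fun s => by
    rw [coordSumLaw, ← (iIndepFun_iff_map_fun_eq_pi_map hXm).1 hindep,
      AEMeasurable.map_map_of_aemeasurable (by fun_prop) (aemeasurable_pi_lambda _ hXm)]
    rfl
  simp only [hlaw] at hAC ⊢
  choose! p hp using hAC
  have hr : ∀ i, (C.filter fun s => i ∈ s).card ≤ maxDegree C := fun i =>
    Finset.le_sup (f := fun i : Fin n => (C.filter fun s => i ∈ s).card) (Finset.mem_univ i)
  have hr0 : maxDegree C ≠ 0 := by
    obtain ⟨s, hs, -⟩ := exists_mem_ne_zero hw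
    obtain ⟨i, hi⟩ : s.Nonempty := by
      by_contra hne
      rw [Finset.not_nonempty_iff_eq_empty] at hne
      subst hne
      exact not_isACDensity_coordSumLaw_empty μ (hp ∅ hs)
    exact ((Finset.card_pos.2 ⟨s, Finset.mem_filter.2 ⟨hs, hi⟩⟩).trans_le (hr i)).ne'
  refine ⟨fisherInfo_coordSumLaw_univ_le hw hp hr hr0, fun hn hC hfin heq => ?_⟩
  have : Nontrivial (Fin n) := Fin.nontrivial_iff_two_le.2 hn
  obtain ⟨m, v, hmv⟩ := coordSumLaw_univ_eq_gaussianReal_of_eq hμ hw hp hr hr0 hC hfin heq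
  exact exists_eq_gaussianReal_of_coordSumLaw_univ hμ hmv
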